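/- Let $\mathcal G$ be a class of finite simple graphs, the $n$-vertex ones being labelled by $\{1,\dots,n\}$, that is closed under isomorphism. A graph is called 2-connected here if it has at least two vertices, is connected, and remains connected after deleting any one vertex (so a single edge is 2-connected); a block of a graph is a maximal 2-connected subgraph. Assume that $\mathcal G$ is block-stable: it contains the single edge, and a connected graph belongs to $\mathcal G$ if and only if all of its blocks do. Let $\mathcal C$ and $\mathcal B$ be the sets of connected and of 2-connected graphs in $\mathcal G$. Given a graph $g$ and $I\subseteq V(g)$, say that a vertex has type $0$ if it lies in $I$, type $1$ if it is at distance exactly one from $I$, and type $2$ otherwise. A pointed graph is a graph whose vertex with the largest label is distinguished; this vertex is discounted, so that a pointed graph on $n+1$ vertices with $k_j$ non-pointed vertices of type $j$ contributes $\frac{x^{n}}{n!}\prod_j y_j^{k_j}$ to a generating function. Define the following formal power series with rational coefficients. * For $i\in\{0,1,2\}$, $B_i(x,y_0,y_1,y_2)$ is the generating function of pairs $(I,b)$ where $b\in\mathcal B$ is pointed, $I$ is an independent set of $b$ (not necessarily maximal), and the pointed vertex has type $i$ with respect to $I$. * For $i\in\{0,1\}$, $C_i(x,y_0,y_1)$ is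 the generating function of pairs $(J,g)$ where $g\in\mathcal C$ is pointed, $J$ is a maximal independent set of $g$ (each vertex outside $J$ has a neighbour in $J$), and the pointed vertex has type $i$ with respect to $J$. * $C_2(x,y_0,y_1)$ is the generating function of pairs $(J,g)$ where $g\in\mathcal C$ is pointed and $J$ is an independent set of $g$ such that the pointed vertex has type $2$ with respect to $J$ and every other vertex has type $0$ or $1$. Then, as identities of formal power series, $$\begin{aligned} C_0 &= \exp\bigl(B_0(x,\,y_0C_0,\,y_1(C_1+C_2),\,y_1C_1)\bigr),\\ C_1 &= \bigl(\exp\bigl(B_1(x,\,y_0C_0,\,y_1(C_1+C_2),\,y_1C_1)\bigr)-1\bigr)\cdot C_2,\\ C_2 &= \exp\bigl(B_2(x,\,y_0C_0,\,y_1(C_1+C_2),\,y_1C_1)\bigr). \end{aligned}$$ -/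

import Mathlib

namespace BlockEGF

/-- A graph is 2-connected (in the sense used for blocks, so that a single edge is 2-connected and
a single vertex is not) if it has at least two vertices, is connected, and stays connected after
the deletion of any one vertex. -/
def IsTwoConnected {V : Type*} (G : SimpleGraph V) : Prop :=
  Nontrivial V ∧ G.Connected ∧ ∀ v : V, (G.induce ({v}ᶜ : Set V)).Connected

/-- A block of `G` is a maximal 2-connected subgraph of `G`. -/
def IsBlock {V : Type*} (G : SimpleGraph V) (H : G.Subgraph) : Prop :=
  Maximal (fun K : G.Subgraph => IsTwoConnected K.coe) H

/-- A class of labelled graphs: for every `n` a set of graphs on the labels `0, …, n - 1`, such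
that the whole class is stable under graph isomorphism. -/
structure GraphClass where
  graphs : ∀ n : ℕ, Set (SimpleGraph (Fin n))
  iso_mem : ∀ (n : ℕ) (G H : SimpleGraph (Fin n)), Nonempty (G ≃g H) → G ∈ graphs n → H ∈ graphs n

/-- A graph on an arbitrary vertex set belongs to the class if it is isomorphic to a labelled graph
of the class. -/
def GraphClass.Mem (𝒢 : GraphClass) {V : Type*} (G : SimpleGraph V) : Prop :=
  ∃ (n : ℕ) (K : SimpleGraph (Fin n)), K ∈ 𝒢.graphs n ∧ Nonempty (G ≃g K)

/-- A class is block-stable if it contains the single edge, and a connected graph belongs to it if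
and only if each of its blocks does. -/
def GraphClass.BlockStable (𝒢 : GraphClass) : Prop :=
  (⊤ : SimpleGraph (Fin 2)) ∈ 𝒢.graphs 2 ∧
  ∀ (n : ℕ) (G : SimpleGraph (Fin n)), G.Connected →
    (G ∈ 𝒢.graphs n ↔ ∀ H : G.Subgraph, IsBlock G H → 𝒢.Mem H.coe)

open Classical in
/-- The type of a vertex with respect to a set `I` of vertices: `0` if it lies in `I`, `1` if it
is at distance exactly one from `I`, and `2` if it is at distance at least two from `I`
(in particular if `I` is empty). -/
noncomputable def vertexType {V : Type*} (G : SimpleGraph V) (I : Set V) (v : V) : ℕ :=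
  if v ∈ I then 0 else if ∃ u ∈ I, G.Adj u v then 1 else 2

/-- An independent set `J` is maximal if every vertex outside `J` has a neighbour in `J`. -/
def IsMaximalIndepSet {V : Type*} (G : SimpleGraph V) (J : Set V) : Prop :=
  G.IsIndepSet J ∧ ∀ v, v ∉ J → ∃ u ∈ J, G.Adj u v

/-- `J` makes the graph `G` pointed at `r` special: `J` is independent, the pointed vertex is at
distance at least two from `J`, and every other vertex is in `J` or at distance one from `J`. -/
def IsSpecialIndepSet {V : Type*} (G : SimpleGraph V) (J : Set V) (r : V) : Prop :=
  G.IsIndepSet J ∧ vertexType G J r = 2 ∧ ∀ v, v ≠ r → vertexType G J v = 0 ∨ vertexType G J v = 1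

/-- The generating function of a family `P` of pairs (pointed graph, set of vertices). A pointed
graph of size `n` has `n + 1` labelled vertices; the pointed vertex is the one with the largest
label, and it is discounted. The variable `X 0` is exponential and marks vertices; for `j < k` the
ordinary variable `X (j + 1)` marks the vertices of type `j`. -/
noncomputable def pointedEGF (k : ℕ)
    (P : ∀ n : ℕ, SimpleGraph (Fin (n + 1)) → Set (Fin (n + 1)) → Prop) :
    MvPowerSeries (Fin (k + 1)) ℚ := fun m =>
  (Nat.card {p : SimpleGraph (Fin (m 0 + 1)) × Set (Fin (m 0 + 1)) //
      P (m 0) p.1 p.2 ∧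
      ∀ j : Fin k, {v | v ≠ Fin.last (m 0) ∧ vertexType p.1 p.2 v = j}.ncard = m j.succ} : ℚ) /
    ((m 0).factorial : ℚ)

/-- `Bᵢ(x, y₀, y₁, y₂)`: pointed coloured blocks, that is, pointed 2-connected graphs of the class
with an arbitrary independent set `I`, whose pointed vertex has type `i` with respect to `I`. -/
noncomputable def GraphClass.B (𝒢 : GraphClass) (i : Fin 3) : MvPowerSeries (Fin 4) ℚ :=
  pointedEGF 3 fun n b I =>
    b ∈ 𝒢.graphs (n + 1) ∧ IsTwoConnected b ∧ b.IsIndepSet I ∧ vertexType b I (Fin.last n) = i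

/-- `C₀(x, y₀, y₁)`: pointed connected graphs of the class with a maximal independent set `J`
that contains the pointed vertex. -/
noncomputable def GraphClass.C₀ (𝒢 : GraphClass) : MvPowerSeries (Fin 3) ℚ :=
  pointedEGF 2 fun n g J =>
    g ∈ 𝒢.graphs (n + 1) ∧ g.Connected ∧ IsMaximalIndepSet g J ∧ vertexType g J (Fin.last n) = 0

/-- `C₁(x, y₀, y₁)`: pointed connected graphs of the class with a maximal independent set `J`
at distance exactly one from the pointed vertex. -/
noncomputable def GraphClass.C₁ (𝒢 : GraphClass) : MvPowerSeries (Fin 3) ℚ :=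
  pointedEGF 2 fun n g J =>
    g ∈ 𝒢.graphs (n + 1) ∧ g.Connected ∧ IsMaximalIndepSet g J ∧ vertexType g J (Fin.last n) = 1

/-- `C₂(x, y₀, y₁)`: special pointed coloured graphs of the class. -/
noncomputable def GraphClass.C₂ (𝒢 : GraphClass) : MvPowerSeries (Fin 3) ℚ :=
  pointedEGF 2 fun n g J =>
    g ∈ 𝒢.graphs (n + 1) ∧ g.Connected ∧ IsSpecialIndepSet g J (Fin.last n)

open MvPowerSeries in
/-- The substitution `(x, y₀, y₁, y₂) ↦ (x, y₀ C₀, y₁ (C₁ + C₂), y₁ C₁)`. -/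
noncomputable def GraphClass.args (𝒢 : GraphClass) : Fin 4 → MvPowerSeries (Fin 3) ℚ :=
  ![X 0, X 1 * 𝒢.C₀, X 2 * (𝒢.C₁ + 𝒢.C₂), X 2 * 𝒢.C₁]

/-- The formal power series `exp f`, for `f` with zero constant coefficient. -/
noncomputable def expSeries {σ : Type*} (f : MvPowerSeries σ ℚ) : MvPowerSeries σ ℚ :=
  (PowerSeries.exp ℚ).subst f

/-- `Bᵢ(x, y₀ C₀, y₁ (C₁ + C₂), y₁ C₁)`. -/
noncomputable def GraphClass.Bsubst (𝒢 : GraphClass) (i : Fin 3) : MvPowerSeries (Fin 3) ℚ :=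
  (𝒢.B i).subst 𝒢.args

/- The substitutions and exponentials above are well defined. -/

theorem GraphClass.constantCoeff_args (𝒢 : GraphClass) (i : Fin 4) :
    MvPowerSeries.constantCoeff (𝒢.args i) = 0 := by
  fin_cases i <;> simp [GraphClass.args]

theorem GraphClass.hasSubst_args (𝒢 : GraphClass) : MvPowerSeries.HasSubst 𝒢.args :=
  MvPowerSeries.hasSubst_of_constantCoeff_zero 𝒢.constantCoeff_args

theorem GraphClass.constantCoeff_B (𝒢 : GraphClass) (i : Fin 3) :
    MvPowerSeries.constantCoeff (𝒢.B i) = 0 := by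
  rw [← MvPowerSeries.coeff_zero_eq_constantCoeff_apply]
  change (Nat.card _ : ℚ) / _ = 0
  rw [div_eq_zero_iff]
  left
  rw [Nat.cast_eq_zero, Nat.card_eq_zero]
  left
  refine ⟨fun p => ?_⟩
  have h : Nontrivial (Fin 1) := p.2.1.2.1.1
  exact not_nontrivial _ h

theorem GraphClass.constantCoeff_Bsubst (𝒢 : GraphClass) (i : Fin 3) :
    MvPowerSeries.constantCoeff (𝒢.Bsubst i) = 0 :=
  MvPowerSeries.constantCoeff_subst_eq_zero 𝒢.hasSubst_args 𝒢.constantCoeff_args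
    (𝒢.constantCoeff_B i)

theorem GraphClass.hasSubst_Bsubst (𝒢 : GraphClass) (i : Fin 3) :
    PowerSeries.HasSubst (𝒢.Bsubst i) :=
  PowerSeries.HasSubst.of_constantCoeff_zero (𝒢.constantCoeff_Bsubst i)

end BlockEGF

/-! Let `S_T` be the series in `x` of coloured connected rooted graphs of the class whose root has
type in `T` and whose other vertices all have type 0 or 1, and let `E_T` be the corresponding series
for graphs whose root lies in a single block. The proof peels off one block at a time and solves a
differential equation.

Fix a root `r` and a second vertex `w` of a connected graph. Exactly one block at `r` leads towards
`w`. It is encoded by a retraction `p` of the vertex set onto that block, with `p r = r` and `p w ≠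
r`, whose fibres are the connected pieces hanging at the block vertices (`exists_isRetraction`,
`IsRetraction.unique`). Block-stability says that the graph is in the class iff the block and all
pieces are. Colourings decompose too. A piece at a non-root block vertex of type 0, 1 or 2 in the
block must have root type in `{0}`, `{1, 2}` or `{1}` respectively: a vertex already dominated in
the block needs nothing more, an undominated one must be dominated inside its piece. This produces
the arguments `y₀C₀`, `y₁(C₁+C₂)`, `y₁C₁`. The piece at `r` is again a rooted graph with root type
in `T`, provided that `T` is `{0}`, `{1, 2}` or `{2}`.

Summing over all ordered pairs `(r, w)` gives `x · (x S_T') = (x S_T) · (x E_T')`, hence `S_T' = S_T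
E_T'` (`derivative_rootedSeries`). As `S_T` has constant term 1, `S_T = exp E_T`. The set `{1}` is
reached indirectly: `S_{1} + S_{2} = exp (E_{1} + E_{2}) = exp E_{1} · S_{2}`.

Finally `finSuccEquiv` singles out the variable `x`, turning `Cᵢ` into `S_{i}` and the substituted
`Bᵢ` into `E_{i}` (`finSuccEquiv_Bsubst`). -/

namespace BlockEGF

/-! ### Connectedness and 2-connectedness of vertex sets -/

section Connectivity

variable {V W : Type*}

/-- The set `X` induces a connected subgraph of `G`, in terms of sets closed under adjacency. -/
def Conn (G : SimpleGraph V) (X : Set V) : Prop :=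
  X.Nonempty ∧ ∀ U : Set V, (X ∩ U).Nonempty →
    (∀ u ∈ X ∩ U, ∀ v ∈ X, G.Adj u v → v ∈ U) → X ⊆ U

/-- The set `X` induces a 2-connected subgraph of `G`. -/
def TwoConn (G : SimpleGraph V) (X : Set V) : Prop :=
  X.Nontrivial ∧ Conn G X ∧ ∀ v ∈ X, Conn G (X \ {v})

theorem connected_iff_conn_univ (G : SimpleGraph V) : G.Connected ↔ Conn G Set.univ := by
  constructor
  · intro h
    have := h.nonempty
    refine ⟨Set.univ_nonempty, ?_⟩
    rintro U ⟨u, -, hu⟩ hU v -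
    obtain ⟨p⟩ := h.preconnected u v
    induction p with
    | nil => exact hu
    | cons hadj p ih => exact ih (hU _ ⟨trivial, hu⟩ _ trivial hadj)
  · rintro ⟨⟨x, -⟩, h⟩
    refine (SimpleGraph.connected_iff _).mpr ⟨fun u v => ?_, ⟨x⟩⟩
    refine h {w | G.Reachable u w} ⟨u, trivial, SimpleGraph.Reachable.refl _⟩ ?_ (Set.mem_univ v)
    rintro a ⟨-, ha⟩ b - hab
    exact SimpleGraph.Reachable.trans ha hab.reachable

theorem conn_comap (G : SimpleGraph V) (e : W → V) (he : Function.Injective e) (Y : Set W) :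
    Conn (G.comap e) Y ↔ Conn G (e '' Y) := by
  constructor
  · rintro ⟨hne, h⟩
    refine ⟨hne.image e, ?_⟩
    rintro U ⟨_, ⟨y, hy, rfl⟩, hyU⟩ hU
    have := h (e ⁻¹' U) ⟨y, hy, hyU⟩ (fun u hu v hv huv =>
      hU (e u) ⟨⟨u, hu.1, rfl⟩, hu.2⟩ (e v) ⟨v, hv, rfl⟩ huv)
    rintro _ ⟨v, hv, rfl⟩
    exact this hv
  · rintro ⟨hne, h⟩
    refine ⟨by simpa using hne, ?_⟩
    rintro U ⟨y, hy, hyU⟩ hU v hv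
    have := h (e '' U) ⟨e y, ⟨y, hy, rfl⟩, ⟨y, hyU, rfl⟩⟩ (by
      rintro _ ⟨⟨u, hu, rfl⟩, ⟨u', hu', huu⟩⟩ _ ⟨v, hv, rfl⟩ huv
      rw [he huu] at hu'
      exact ⟨v, hU u ⟨hu, hu'⟩ v hv huv, rfl⟩) ⟨v, hv, rfl⟩
    obtain ⟨v', hv', h'⟩ := this
    rwa [← he h']

theorem twoConn_comap (G : SimpleGraph V) (e : W → V) (he : Function.Injective e) (Y : Set W) :
    TwoConn (G.comap e) Y ↔ TwoConn G (e '' Y) := by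
  unfold TwoConn
  rw [conn_comap G e he]
  refine and_congr ⟨fun h => h.image he, fun h => ?_⟩ (and_congr Iff.rfl ?_)
  · obtain ⟨_, ⟨a, ha, rfl⟩, _, ⟨b, hb, rfl⟩, hab⟩ := h
    exact ⟨a, ha, b, hb, fun h => hab (congrArg e h)⟩
  · rw [Set.forall_mem_image]
    refine forall₂_congr fun v hv => ?_
    rw [conn_comap G e he, Set.image_sdiff he, Set.image_singleton]

theorem isTwoConnected_iff (G : SimpleGraph V) : IsTwoConnected G ↔ TwoConn G Set.univ := by
  unfold IsTwoConnected TwoConn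
  rw [connected_iff_conn_univ, Set.nontrivial_univ_iff]
  refine and_congr Iff.rfl (and_congr Iff.rfl ?_)
  simp only [Set.mem_univ, true_imp_iff, ← Set.compl_eq_univ_sdiff]
  refine forall_congr' fun v => ?_
  rw [connected_iff_conn_univ, SimpleGraph.induce, conn_comap _ _ (Function.Embedding.injective _)]
  simp [← Set.compl_singleton_eq]

theorem connected_comap_iff (G : SimpleGraph V) (e : W → V) (he : Function.Injective e) :
    (G.comap e).Connected ↔ Conn G (Set.range e) := by
  rw [connected_iff_conn_univ, conn_comap G e he, Set.image_univ]

theorem isTwoConnected_comap_iff (G : SimpleGraph V) (e : W → V) (he : Function.Injective e) :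
    IsTwoConnected (G.comap e) ↔ TwoConn G (Set.range e) := by
  rw [isTwoConnected_iff, twoConn_comap G e he, Set.image_univ]

theorem Conn.mono {G H : SimpleGraph V} (h : G ≤ H) {X : Set V} (hX : Conn G X) : Conn H X :=
  ⟨hX.1, fun U hU hc => hX.2 U hU fun u hu v hv huv => hc u hu v hv (h huv)⟩

theorem TwoConn.mono {G H : SimpleGraph V} (h : G ≤ H) {X : Set V} (hX : TwoConn G X) :
    TwoConn H X :=
  ⟨hX.1, hX.2.1.mono h, fun v hv => (hX.2.2 v hv).mono h⟩

theorem conn_singleton (G : SimpleGraph V) (v : V) : Conn G {v} := by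
  refine ⟨Set.singleton_nonempty v, ?_⟩
  rintro U ⟨u, hu, huU⟩ - w hw
  rw [Set.mem_singleton_iff] at hu hw
  rwa [hw, ← hu]

theorem Conn.union {G : SimpleGraph V} {X Y : Set V} (hX : Conn G X) (hY : Conn G Y)
    (h : (X ∩ Y).Nonempty) : Conn G (X ∪ Y) := by
  refine ⟨hX.1.inl, fun U hU hc => ?_⟩
  have kX : (X ∩ U).Nonempty → X ⊆ U := fun h =>
    hX.2 U h fun u hu v hv => hc u ⟨Or.inl hu.1, hu.2⟩ v (Or.inl hv)
  have kY : (Y ∩ U).Nonempty → Y ⊆ U := fun h =>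
    hY.2 U h fun u hu v hv => hc u ⟨Or.inr hu.1, hu.2⟩ v (Or.inr hv)
  obtain ⟨c, hcX, hcY⟩ := h
  obtain ⟨u, hu | hu, huU⟩ := hU
  · have := kX ⟨u, hu, huU⟩
    exact Set.union_subset this (kY ⟨c, hcY, this hcX⟩)
  · have := kY ⟨u, hu, huU⟩
    exact Set.union_subset (kX ⟨c, hcX, this hcY⟩) this

theorem TwoConn.conn_diff {G : SimpleGraph V} {X : Set V} (hX : TwoConn G X) (v : V) :
    Conn G (X \ {v}) := by
  by_cases h : v ∈ X
  · exact hX.2.2 v h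
  · rw [Set.sdiff_singleton_eq_self h]
    exact hX.2.1

end Connectivity

/-! ### The retraction onto the block at the root that leads to a given vertex -/

section Decomposition

variable {V : Type*}

/-- Every edge of `G` inside `X` lies in a fibre of `p` or joins two fixed points of `p`. -/
def EdgesSplit (G : SimpleGraph V) (p : V → V) (X : Set V) : Prop :=
  ∀ u ∈ X, ∀ v ∈ X, G.Adj u v → p u = p v ∨ (p u = u ∧ p v = v)

/-- The map `p` retracts the connected set `X` onto a 2-connected set `{x ∈ X | p x = x}`, and the
rest of `G` on `X` hangs in connected pieces, the fibres of `p`, at the vertices of this set. -/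
structure IsRetraction (G : SimpleGraph V) (p : V → V) (X : Set V) : Prop where
  mapsTo : ∀ x ∈ X, p x ∈ X
  idem : ∀ x ∈ X, p (p x) = p x
  edges : EdgesSplit G p X
  conn : ∀ b ∈ X, p b = b → Conn G {x ∈ X | p x = b}
  twoConn : TwoConn G {x ∈ X | p x = x}

/-- A 2-connected set cannot cross a cut vertex. If `y ∈ Y` is not fixed, then edges leave its fibre
only at `p y`, so the rest of that fibre is closed under adjacency in the connected set `Y \ {p y}`
and contains it. -/
theorem TwoConn.subset_or_subset {G : SimpleGraph V} {p : V → V} (hidem : ∀ x, p (p x) = p x)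
    (hedge : EdgesSplit G p Set.univ) {Y : Set V} (hY : TwoConn G Y) :
    (∀ y ∈ Y, p y = y) ∨ ∃ b, ∀ y ∈ Y, p y = p b := by
  by_cases h : ∀ y ∈ Y, p y = y
  · exact Or.inl h
  push Not at h
  obtain ⟨y, hy, hpy⟩ := h
  refine Or.inr ⟨y, ?_⟩
  have key := (hY.conn_diff (p y)).2 {u | p u = p y ∧ u ≠ p y} ⟨y, ⟨hy, fun h => hpy h.symm⟩, rfl,
    fun h => hpy h.symm⟩ (by
      rintro u ⟨-, hu, hu'⟩ v ⟨-, hv⟩ huv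
      rcases hedge u trivial v trivial huv with h | h
      · exact ⟨h ▸ hu, hv⟩
      · exact absurd (h.1.symm.trans hu) hu')
  intro z hz
  by_cases hzy : z = p y
  · rw [hzy, hidem]
  · exact (key ⟨hz, hzy⟩).1

/-- A side of a separation of a connected set at the vertex `c` is connected. -/
theorem Conn.side {G : SimpleGraph V} {X U : Set V} {c : V} (hX : Conn G X) (hc : c ∈ X)
    (hU : ∀ u ∈ X, ∀ v ∈ X, u ≠ c → v ≠ c → G.Adj u v → u ∈ U → v ∈ U) :
    Conn G {x ∈ X | x = c ∨ x ∈ U} := by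
  refine ⟨⟨c, hc, Or.inl rfl⟩, ?_⟩
  rintro W ⟨w, ⟨hwX, hwU⟩, hwW⟩ hW
  have hcW : c ∈ W := by
    by_contra hcW
    -- If `W` missed `c`, its part in `U` would be closed in all of `X` and so would contain `c`.
    have := hX.2 {x | x ∈ W ∧ x ∈ U ∧ x ≠ c} ⟨w, hwX, hwW, by grind, by grind⟩ (by
      rintro u ⟨huX, huW, huU, huc⟩ v hv huv
      have hvc : v ≠ c := by
        rintro rfl
        exact hcW (hW u ⟨⟨huX, Or.inr huU⟩, huW⟩ v ⟨hv, Or.inl rfl⟩ huv)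
      have hvU := hU u huX v hv huc hvc huv huU
      exact ⟨hW u ⟨⟨huX, Or.inr huU⟩, huW⟩ v ⟨hv, Or.inr hvU⟩ huv, hvU, hvc⟩)
    exact (this hc).2.2 rfl
  have hsymm : ∀ u ∈ X, ∀ v ∈ X, u ≠ c → v ≠ c → G.Adj u v → v ∈ U → u ∈ U :=
    fun u hu v hv huc hvc huv hvU => hU v hv u hu hvc huc huv.symm hvU
  have key := hX.2 {x | x ∉ U ∨ x ∈ W} ⟨c, hc, Or.inr hcW⟩ (by
    rintro u ⟨huX, hu⟩ v hv huv
    by_cases hvU : v ∈ U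
    · right
      by_cases hvc : v = c
      · rwa [hvc]
      by_cases huc : u = c
      · exact hW u ⟨⟨huX, Or.inl huc⟩, huc ▸ hcW⟩ v ⟨hv, Or.inr hvU⟩ huv
      · have huU := hsymm u huX v hv huc hvc huv hvU
        exact hW u ⟨⟨huX, Or.inr huU⟩, hu.resolve_left (not_not.mpr huU)⟩ v ⟨hv, Or.inr hvU⟩ huv
    · exact Or.inl hvU)
  rintro x ⟨hx, rfl | hxU⟩
  · exact hcW
  · exact (key hx).resolve_left (not_not.mpr hxU)

-- The side `X₂` hangs at `c`, so it joins the fibre of `p c`; the other fibres and the set of fixed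
-- points do not change.
open Classical in
theorem IsRetraction.extend {G : SimpleGraph V} {X₁ X₂ : Set V} {c : V} {p : V → V}
    (h : IsRetraction G p X₁) (hc : c ∈ X₁) (hc₂ : c ∈ X₂) (hdisj : ∀ x ∈ X₁, x ∈ X₂ → x = c)
    (hedge : ∀ u ∈ X₁, ∀ v ∈ X₂, G.Adj u v → u = c ∨ v = c) (hX₂ : Conn G X₂) :
    IsRetraction G (fun x => if x ∈ X₁ then p x else p c) (X₁ ∪ X₂) where
  mapsTo x hx := by
    split_ifs with hx₁
    · exact Or.inl (h.mapsTo x hx₁)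
    · exact Or.inl (h.mapsTo c hc)
  idem x hx := by
    have := h.mapsTo
    have := h.idem
    grind
  edges u hu v hv huv := by
    have := h.edges
    by_cases hu₁ : u ∈ X₁ <;> by_cases hv₁ : v ∈ X₁
    · simpa [hu₁, hv₁] using this u hu₁ v hv₁ huv
    · rcases hedge u hu₁ v (hv.resolve_left hv₁) huv with rfl | rfl
      · simp [hv₁]
      · exact absurd hc hv₁
    · rcases hedge v hv₁ u (hu.resolve_left hu₁) huv.symm with rfl | rfl
      · simp [hu₁]
      · exact absurd hc hu₁
    · simp [hu₁, hv₁]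
  conn b hb hpb := by
    have hb₁ : b ∈ X₁ := by
      by_contra hb₁
      rw [if_neg hb₁] at hpb
      exact hb₁ (hpb ▸ h.mapsTo c hc)
    rw [if_pos hb₁] at hpb
    have hconn := h.conn b hb₁ hpb
    by_cases hcb : p c = b
    · have : {x ∈ X₁ ∪ X₂ | (if x ∈ X₁ then p x else p c) = b} = {x ∈ X₁ | p x = b} ∪ X₂ := by
        ext x
        simp only [Set.mem_sep_iff, Set.mem_union]
        grind
      rw [this]
      exact hconn.union hX₂ ⟨c, ⟨hc, hcb⟩, hc₂⟩
    · have : {x ∈ X₁ ∪ X₂ | (if x ∈ X₁ then p x else p c) = b} = {x ∈ X₁ | p x = b} := by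
        ext x
        simp only [Set.mem_sep_iff, Set.mem_union]
        grind
      rwa [this]
  twoConn := by
    have : {x ∈ X₁ ∪ X₂ | (if x ∈ X₁ then p x else p c) = x} = {x ∈ X₁ | p x = x} := by
      ext x
      have := h.mapsTo c hc
      simp only [Set.mem_sep_iff, Set.mem_union]
      grind
    rw [this]
    exact h.twoConn

/-- Induction on the size of `X`. If `X` is 2-connected, the identity works. Otherwise cut at some
`c`, retract the side that contains `r` (the side of `w` if `r = c`), and hang the other side at `c`
by `IsRetraction.extend`. -/
theorem exists_isRetraction [Finite V] (G : SimpleGraph V) (X : Set V) (hX : Conn G X) {r w : V}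
    (hr : r ∈ X) (hw : w ∈ X) (hrw : w ≠ r) :
    ∃ p, IsRetraction G p X ∧ p r = r ∧ p w ≠ r := by
  classical
  induction h : X.ncard using Nat.strong_induction_on generalizing X r w with
  | _ n ih =>
  subst h
  by_cases h2 : TwoConn G X
  · refine ⟨id, ⟨fun x hx => hx, fun x _ => rfl, fun u _ v _ _ => Or.inr ⟨rfl, rfl⟩,
      fun b hb _ => ?_,
      by simpa using h2⟩, rfl, hrw⟩
    have : {x ∈ X | id x = b} = {b} := by
      ext x
      simp only [id, Set.mem_sep_iff, Set.mem_singleton_iff]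
      exact ⟨fun h => h.2, fun h => ⟨h ▸ hb, h⟩⟩
    rw [this]
    exact conn_singleton G b
  have hnt : X.Nontrivial := ⟨r, hr, w, hw, hrw.symm⟩
  obtain ⟨c, hcX, hc⟩ : ∃ c ∈ X, ¬ Conn G (X \ {c}) := by
    by_contra hcon
    push Not at hcon
    exact h2 ⟨hnt, hX, hcon⟩
  have hne : (X \ {c}).Nonempty := by
    obtain ⟨y, hy, hyc⟩ := hnt.exists_ne c
    exact ⟨y, hy, hyc⟩
  obtain ⟨U, ⟨a, haX, haU⟩, hU, b, hbX, hbU⟩ : ∃ U : Set V, ((X \ {c}) ∩ U).Nonempty ∧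
      (∀ u ∈ (X \ {c}) ∩ U, ∀ v ∈ X \ {c}, G.Adj u v → v ∈ U) ∧ ∃ b ∈ X \ {c}, b ∉ U := by
    by_contra hcon
    refine hc ⟨hne, fun U hU hcl b hb => ?_⟩
    by_contra hbU
    exact hcon ⟨U, hU, hcl, b, hb, hbU⟩
  have step : ∀ U : Set V, (∃ b ∈ X \ {c}, b ∉ U) →
      (∀ u ∈ X, ∀ v ∈ X, u ≠ c → v ≠ c → G.Adj u v → (u ∈ U ↔ v ∈ U)) →
      (r = c ∨ r ∈ U) → (r = c → w ∈ U) →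
      ∃ p, IsRetraction G p X ∧ p r = r ∧ p w ≠ r := by
    rintro U ⟨b, hb, hbU⟩ hU hrU hrcw
    set X₁ : Set V := {x ∈ X | x = c ∨ x ∈ U} with hX₁
    set X₂ : Set V := {x ∈ X | x = c ∨ x ∈ Uᶜ} with hX₂
    have hunion : X₁ ∪ X₂ = X := by
      ext x
      simp only [hX₁, hX₂, Set.mem_union, Set.mem_sep_iff, Set.mem_compl_iff]
      grind
    have hlt : X₁.ncard < X.ncard := by
      refine Set.ncard_lt_ncard ⟨fun x hx => hx.1, fun hsub => ?_⟩ (Set.toFinite X)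
      rcases (hsub hb.1).2 with h | h
      · exact hb.2 h
      · exact hbU h
    have hconn₁ : Conn G X₁ := hX.side hcX fun u hu v hv huc hvc huv huU =>
      (hU u hu v hv huc hvc huv).mp huU
    have hconn₂ : Conn G X₂ := hX.side hcX fun u hu v hv huc hvc huv huU hvU =>
      huU ((hU u hu v hv huc hvc huv).mpr hvU)
    have hext := fun p (hp : IsRetraction G p X₁) => hp.extend (X₂ := X₂) (c := c)
      ⟨hcX, Or.inl rfl⟩ ⟨hcX, Or.inl rfl⟩ (fun x h₁ h₂ => by
        by_contra hxc
        exact (h₂.2.resolve_left hxc) (h₁.2.resolve_left hxc)) (fun u hu v hv huv => by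
        by_contra hcon
        push Not at hcon
        exact (hv.2.resolve_left hcon.2)
          ((hU u hu.1 v hv.1 hcon.1 hcon.2 huv).mp (hu.2.resolve_left hcon.1))) hconn₂
    rw [hunion] at hext
    have hr₁ : r ∈ X₁ := ⟨hr, hrU⟩
    have hc₁ : c ∈ X₁ := ⟨hcX, Or.inl rfl⟩
    by_cases hw₁ : w ∈ X₁
    · obtain ⟨p, hp, hpr, hpw⟩ := ih _ hlt X₁ hconn₁ hr₁ hw₁ hrw rfl
      exact ⟨_, hext p hp, by simpa [hr₁] using hpr, by simpa [hw₁] using hpw⟩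
    -- Here `w` lies beyond `c`, and the extended map sends it to `p c`, so `c` takes over the role
    -- of `w` in the induction.
    · have hrc : c ≠ r := fun h => hw₁ ⟨hw, Or.inr (hrcw h.symm)⟩
      obtain ⟨p, hp, hpr, hpw⟩ := ih _ hlt X₁ hconn₁ hr₁ hc₁ hrc rfl
      exact ⟨_, hext p hp, by simpa [hr₁] using hpr, by simpa [hw₁] using hpw⟩
  have hU' : ∀ u ∈ X, ∀ v ∈ X, u ≠ c → v ≠ c → G.Adj u v → (u ∈ U ↔ v ∈ U) :=
    fun u hu v hv huc hvc huv => ⟨fun h => hU u ⟨⟨hu, huc⟩, h⟩ v ⟨hv, hvc⟩ huv,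
      fun h => hU v ⟨⟨hv, hvc⟩, h⟩ u ⟨hu, huc⟩ huv.symm⟩
  have hU'' : ∀ u ∈ X, ∀ v ∈ X, u ≠ c → v ≠ c → G.Adj u v → (u ∈ Uᶜ ↔ v ∈ Uᶜ) :=
    fun u hu v hv huc hvc huv => not_congr (hU' u hu v hv huc hvc huv)
  by_cases hrc : r = c
  · by_cases hwU : w ∈ U
    · exact step U ⟨b, hbX, hbU⟩ hU' (Or.inl hrc) fun _ => hwU
    · exact step Uᶜ ⟨a, haX, not_not.mpr haU⟩ hU'' (Or.inl hrc) fun _ => hwU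
  · by_cases hrU : r ∈ U
    · exact step U ⟨b, hbX, hbU⟩ hU' (Or.inr hrU) fun h => absurd h hrc
    · exact step Uᶜ ⟨a, haX, not_not.mpr haU⟩ hU'' (Or.inr hrU) fun h => absurd h hrc

/-- The fixed points of `q` form a 2-connected set, so `p` fixes them all or they lie in one fibre
of `p`. In the second case it is the fibre of `r`, which can only be left through `r`. The `q`-fibre
of `w` is connected, meets that fibre and avoids `r`, so it stays there, contradicting `p w ≠ r`. -/
theorem IsRetraction.fixed_of_fixed {G : SimpleGraph V} {p q : V → V}
    (hp : IsRetraction G p Set.univ) (hq : IsRetraction G q Set.univ) {r w : V}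
    (hpr : p r = r) (hpw : p w ≠ r) (hqr : q r = r) (hqw : q w ≠ r) {x : V} (hx : q x = x) :
    p x = x := by
  rcases TwoConn.subset_or_subset (fun x => hp.idem x trivial) hp.edges hq.twoConn with h | ⟨b, hb⟩
  · exact h x ⟨trivial, hx⟩
  exfalso
  have hbr : p b = r := by rw [← hb r ⟨trivial, hqr⟩, hpr]
  have hqqw := hq.idem w trivial
  have key := (hq.conn (q w) trivial hqqw).2 {x | p x = r ∧ x ≠ r}
    ⟨q w, ⟨trivial, hqqw⟩, (hb _ ⟨trivial, hqqw⟩).trans hbr, hqw⟩ (by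
      rintro u ⟨-, hu, hur⟩ v ⟨-, hv⟩ huv
      rcases hp.edges u trivial v trivial huv with h | h
      · refine ⟨h ▸ hu, ?_⟩
        rintro rfl
        exact hqw (hv.symm.trans hqr)
      · exact absurd (h.1.symm.trans hu) hur)
  exact hpw (key ⟨trivial, rfl⟩).1

/-- By symmetry `p` and `q` have the same fixed points. An edge that changes the value of `p` joins
two of these, and a fibre of `q` contains only one, so `p` is constant on the connected fibres of
`q`. -/
theorem IsRetraction.unique {G : SimpleGraph V} {p q : V → V}
    (hp : IsRetraction G p Set.univ) (hq : IsRetraction G q Set.univ) {r w : V}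
    (hpr : p r = r) (hpw : p w ≠ r) (hqr : q r = r) (hqw : q w ≠ r) : p = q := by
  have h₁ := fun x => hp.fixed_of_fixed hq hpr hpw hqr hqw (x := x)
  have h₂ := fun x => hq.fixed_of_fixed hp hqr hqw hpr hpw (x := x)
  funext x
  have hqx := hq.idem x trivial
  have key := (hq.conn (q x) trivial hqx).2 {y | p y = q x} ⟨q x, ⟨trivial, hqx⟩, h₁ _ hqx⟩ (by
    rintro u ⟨-, hu⟩ v ⟨-, hv⟩ huv
    rcases hp.edges u trivial v trivial huv with h | h
    · exact h.symm.trans hu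
    · have := h₂ v h.2
      change p v = q x
      rw [h.2, ← this, hv])
  exact key ⟨trivial, rfl⟩

theorem conn_univ_of_fibers {G : SimpleGraph V} {p : V → V} (hidem : ∀ x, p (p x) = p x)
    (hfix : Conn G {x | p x = x}) (hfib : ∀ b, p b = b → Conn G {x | p x = b}) :
    Conn G Set.univ := by
  obtain ⟨x, hx⟩ := hfix.1
  refine ⟨⟨x, trivial⟩, ?_⟩
  rintro U ⟨u, -, hu⟩ hU
  have hU' : ∀ Y : Set V, ∀ u ∈ Y ∩ U, ∀ v ∈ Y, G.Adj u v → v ∈ U :=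
    fun Y u hu v hv => hU u ⟨trivial, hu.2⟩ v trivial
  have h₁ := (hfib (p u) (hidem u)).2 U ⟨u, rfl, hu⟩ (hU' _)
  have h₂ := hfix.2 U ⟨p u, hidem u, h₁ (hidem u)⟩ (hU' _)
  intro v _
  exact (hfib (p v) (hidem v)).2 U ⟨p v, hidem v, h₂ (hidem v)⟩ (hU' _) rfl

end Decomposition

end BlockEGF

namespace BlockEGF

/-! ### Blocks as vertex sets, and membership in a block-stable class -/

section Membership

variable {V W : Type*} {𝒢 : GraphClass}

theorem GraphClass.Mem.of_iso {G : SimpleGraph V} {H : SimpleGraph W} (e : G ≃g H)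
    (h : 𝒢.Mem H) : 𝒢.Mem G := by
  obtain ⟨n, K, hK, ⟨e'⟩⟩ := h
  exact ⟨n, K, hK, ⟨e.trans e'⟩⟩

theorem GraphClass.mem_iff_of_iso {G : SimpleGraph V} {H : SimpleGraph W} (e : G ≃g H) :
    𝒢.Mem G ↔ 𝒢.Mem H :=
  ⟨.of_iso e.symm, .of_iso e⟩

theorem GraphClass.mem_fin_iff {n : ℕ} (G : SimpleGraph (Fin n)) : 𝒢.Mem G ↔ G ∈ 𝒢.graphs n := by
  constructor
  · rintro ⟨m, K, hK, ⟨e⟩⟩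
    obtain rfl : n = m := by simpa using Fintype.card_congr e.toEquiv
    exact 𝒢.iso_mem _ K G ⟨e.symm⟩ hK
  · exact fun h => ⟨n, G, h, ⟨SimpleGraph.Iso.refl⟩⟩

/-- The graphs that two injections with the same range induce are isomorphic. -/
theorem GraphClass.mem_comap_congr {W' : Type*} (G : SimpleGraph V) {e : W → V} {e' : W' → V}
    (he : Function.Injective e) (he' : Function.Injective e') (h : Set.range e = Set.range e') :
    𝒢.Mem (G.comap e) ↔ 𝒢.Mem (G.comap e') := by
  refine GraphClass.mem_iff_of_iso ⟨(Equiv.ofInjective e he).trans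
    ((Equiv.setCongr h).trans (Equiv.ofInjective e' he').symm), ?_⟩
  intro a b
  have key : ∀ x, e' ((Equiv.ofInjective e' he').symm (Equiv.setCongr h (Equiv.ofInjective e he x)))
      = e x := fun x => Equiv.apply_ofInjective_symm he' _
  change G.Adj (e' _) (e' _) ↔ G.Adj (e a) (e b)
  rw [← key a, ← key b]
  rfl

theorem twoConn_verts {G : SimpleGraph V} {H : G.Subgraph} (h : IsTwoConnected H.coe) :
    TwoConn G H.verts := by
  have h₁ : H.coe ≤ G.comap (Subtype.val : H.verts → V) := fun a b hab => H.adj_sub hab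
  have h₂ := ((isTwoConnected_iff _).mp h).mono h₁
  rw [twoConn_comap _ _ Subtype.val_injective] at h₂
  simpa using h₂

theorem coe_induce_top (G : SimpleGraph V) (X : Set V) :
    ((⊤ : G.Subgraph).induce X).coe = G.comap (Subtype.val : X → V) := by
  ext a b
  simp only [SimpleGraph.Subgraph.coe_adj, SimpleGraph.Subgraph.induce_adj,
    SimpleGraph.Subgraph.top_adj]
  exact ⟨fun h => h.2.2, fun h => ⟨a.2, b.2, h⟩⟩

theorem isTwoConnected_coe_induce_top {G : SimpleGraph V} {X : Set V} (h : TwoConn G X) :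
    IsTwoConnected ((⊤ : G.Subgraph).induce X).coe := by
  rw [coe_induce_top]
  refine (isTwoConnected_comap_iff G _ Subtype.val_injective).mpr ?_
  simpa using h

theorem le_induce_top {G : SimpleGraph V} {H : G.Subgraph} {X : Set V} (h : H.verts ⊆ X) :
    H ≤ (⊤ : G.Subgraph).induce X :=
  ⟨h, fun _ _ hab => ⟨h (H.edge_vert hab), h (H.edge_vert hab.symm), H.adj_sub hab⟩⟩

/-- Adding edges preserves 2-connectedness, so a maximal 2-connected subgraph is induced. Blocks may
therefore be treated as maximal 2-connected vertex sets. -/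
theorem IsBlock.eq_induce_top {G : SimpleGraph V} {H : G.Subgraph} (h : IsBlock G H) :
    H = (⊤ : G.Subgraph).induce H.verts :=
  le_antisymm (le_induce_top subset_rfl)
    (h.2 (isTwoConnected_coe_induce_top (twoConn_verts h.1)) (le_induce_top subset_rfl))

theorem IsBlock.maximal_verts {G : SimpleGraph V} {H : G.Subgraph} (h : IsBlock G H) :
    Maximal (TwoConn G) H.verts :=
  ⟨twoConn_verts h.1, fun _ hY hle =>
    (h.2 (isTwoConnected_coe_induce_top hY) (le_induce_top hle)).1⟩

theorem isBlock_induce_top {G : SimpleGraph V} {X : Set V} (h : Maximal (TwoConn G) X) :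
    IsBlock G ((⊤ : G.Subgraph).induce X) :=
  ⟨isTwoConnected_coe_induce_top h.1, fun _ hK hle =>
    le_induce_top (h.2 (twoConn_verts hK) hle.1)⟩

theorem GraphClass.BlockStable.mem_fin_iff_maximal (h𝒢 : 𝒢.BlockStable) {n : ℕ}
    (G : SimpleGraph (Fin n)) (hG : G.Connected) :
    𝒢.Mem G ↔ ∀ X, Maximal (TwoConn G) X → 𝒢.Mem (G.comap (Subtype.val : X → Fin n)) := by
  rw [GraphClass.mem_fin_iff, h𝒢.2 n G hG]
  constructor
  · intro h X hX
    rw [← coe_induce_top]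
    exact h _ (isBlock_induce_top hX)
  · intro h H hH
    rw [hH.eq_induce_top, coe_induce_top]
    exact h _ hH.maximal_verts

theorem maximal_twoConn_comap {G : SimpleGraph V} (e : W ≃ V) {X : Set W} :
    Maximal (TwoConn (G.comap e)) X ↔ Maximal (TwoConn G) (e '' X) := by
  constructor
  · rintro ⟨h, hmax⟩
    refine ⟨(twoConn_comap G e e.injective X).mp h, fun Y hY hle => ?_⟩
    have := hmax (y := e ⁻¹' Y) ((twoConn_comap G e e.injective _).mpr (by
      rwa [Set.image_preimage_eq _ e.surjective])) (Set.image_subset_iff.mp hle)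
    rwa [← Set.image_preimage_eq Y e.surjective, Set.image_subset_image_iff e.injective]
  · rintro ⟨h, hmax⟩
    refine ⟨(twoConn_comap G e e.injective X).mpr h, fun Y hY hle => ?_⟩
    have := hmax ((twoConn_comap G e e.injective _).mp hY) (Set.image_mono hle)
    rwa [Set.image_subset_image_iff e.injective] at this

theorem GraphClass.BlockStable.mem_iff_maximal [Finite V] (h𝒢 : 𝒢.BlockStable)
    (G : SimpleGraph V) (hG : Conn G Set.univ) :
    𝒢.Mem G ↔ ∀ X, Maximal (TwoConn G) X → 𝒢.Mem (G.comap (Subtype.val : X → V)) := by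
  obtain ⟨n, ⟨e⟩⟩ := Finite.exists_equiv_fin V
  have hiso : 𝒢.Mem G ↔ 𝒢.Mem (G.comap e.symm) :=
    GraphClass.mem_iff_of_iso (SimpleGraph.Iso.comap e.symm G).symm
  rw [hiso, h𝒢.mem_fin_iff_maximal _ ((connected_comap_iff G _ e.symm.injective).mpr (by
    rwa [e.symm.surjective.range_eq]))]
  have key : ∀ X : Set (Fin n), 𝒢.Mem ((G.comap e.symm).comap (Subtype.val : X → Fin n)) ↔
      𝒢.Mem (G.comap (Subtype.val : (e.symm '' X : Set V) → V)) := fun X => by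
    rw [SimpleGraph.comap_comap]
    exact GraphClass.mem_comap_congr G (e.symm.injective.comp Subtype.val_injective)
      Subtype.val_injective (by rw [Set.range_comp, Subtype.range_coe, Subtype.range_coe])
  simp only [maximal_twoConn_comap, key]
  refine ⟨fun h X hX => ?_, fun h X hX => h _ hX⟩
  have := h (e '' X)
  rw [e.symm_image_image] at this
  exact this hX

/-- A connected graph, all of whose 2-connected subgraphs lie in one of some connected pieces that
pairwise share at most one vertex, belongs to a block-stable class if and only if the pieces do. -/
theorem GraphClass.BlockStable.mem_iff_pieces [Finite V] (h𝒢 : 𝒢.BlockStable)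
    {G : SimpleGraph V} (hG : Conn G Set.univ) {ι : Type*} (X : ι → Set V)
    (hconn : ∀ i, Conn G (X i)) (hinter : ∀ i j, i ≠ j → (X i ∩ X j).Subsingleton)
    (hpiece : ∀ Y, TwoConn G Y → ∃ i, Y ⊆ X i) :
    𝒢.Mem G ↔ ∀ i, 𝒢.Mem (G.comap (Subtype.val : X i → V)) := by
  rw [h𝒢.mem_iff_maximal G hG]
  have hX : ∀ i, Conn (G.comap (Subtype.val : X i → V)) Set.univ := fun i => by
    rw [conn_comap _ _ Subtype.val_injective]
    simpa using hconn i
  have hmem : ∀ (i : ι) (Y : Set (X i)),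
      𝒢.Mem ((G.comap (Subtype.val : X i → V)).comap (Subtype.val : Y → X i)) ↔
      𝒢.Mem (G.comap (Subtype.val : (Subtype.val '' Y : Set V) → V)) := fun i Y => by
    rw [SimpleGraph.comap_comap]
    exact GraphClass.mem_comap_congr G (Subtype.val_injective.comp Subtype.val_injective)
      Subtype.val_injective (by rw [Set.range_comp, Subtype.range_coe, Subtype.range_coe])
  constructor
  · intro h i
    rw [h𝒢.mem_iff_maximal _ (hX i)]
    intro Y hY
    rw [hmem]
    have hY2 := (twoConn_comap G _ Subtype.val_injective Y).mp hY.1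
    refine h _ ⟨hY2, fun Z hZ hle => ?_⟩
    obtain ⟨j, hj⟩ := hpiece Z hZ
    -- The image of `Y` has two points and lies in both pieces, while distinct pieces share at most
    -- one vertex.
    obtain rfl : i = j := by
      by_contra hij
      refine Set.not_subsingleton_iff.mpr hY2.1 ((hinter i j hij).anti ?_)
      exact Set.subset_inter (by rintro _ ⟨y, -, rfl⟩; exact y.2) (hle.trans hj)
    have hZ' : Subtype.val '' (Subtype.val ⁻¹' Z : Set (X i)) = Z := by
      rw [Subtype.image_preimage_coe]
      exact Set.inter_eq_right.mpr hj
    have := hY.2 (y := Subtype.val ⁻¹' Z) ((twoConn_comap G _ Subtype.val_injective _).mpr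
      (by rwa [hZ'])) (Set.image_subset_iff.mp hle)
    rw [← hZ']
    exact Set.image_mono this
  · intro h Z hZ
    obtain ⟨i, hi⟩ := hpiece Z hZ.1
    have hZ' : Subtype.val '' (Subtype.val ⁻¹' Z : Set (X i)) = Z := by
      rw [Subtype.image_preimage_coe]
      exact Set.inter_eq_right.mpr hi
    have := (h𝒢.mem_iff_maximal _ (hX i)).mp (h i) (Subtype.val ⁻¹' Z)
      ⟨(twoConn_comap G _ Subtype.val_injective _).mpr (by rw [hZ']; exact hZ.1), fun Y hY hle => by
        rw [twoConn_comap G _ Subtype.val_injective] at hY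
        rw [← Set.image_subset_iff]
        refine hZ.2 hY ?_
        rw [← hZ']
        exact Set.image_mono hle⟩
    rw [hmem, hZ'] at this
    exact this

theorem range_val_fiber {L : Type*} (f : V → L) (l : L) :
    Set.range (Subtype.val : {v // f v = l} → V) = {v | f v = l} :=
  Subtype.range_coe_subtype

/-- Membership in a block-stable class of a graph split by a map `f` with a section `σ`. -/
theorem GraphClass.BlockStable.mem_iff_section [Finite V] (h𝒢 : 𝒢.BlockStable)
    {G : SimpleGraph V} {L : Type*} {f : V → L} {σ : L → V} (hσ : ∀ l, f (σ l) = l)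
    (hedge : EdgesSplit G (σ ∘ f) Set.univ) (hrange : Conn G (Set.range σ))
    (hfib : ∀ l, Conn G {v | f v = l}) :
    𝒢.Mem G ↔ 𝒢.Mem (G.comap σ) ∧
      ∀ l, 𝒢.Mem (G.comap (Subtype.val : {v // f v = l} → V)) := by
  have hσi : Function.Injective σ := Function.LeftInverse.injective hσ
  have hfix : {x | (σ ∘ f) x = x} = Set.range σ := by
    ext x
    exact ⟨fun h => ⟨f x, h⟩, by rintro ⟨l, rfl⟩; simp [hσ]⟩
  have hidem : ∀ x, (σ ∘ f) ((σ ∘ f) x) = (σ ∘ f) x := fun x => by simp [hσ]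
  have hG : Conn G Set.univ := by
    refine conn_univ_of_fibers hidem (by rwa [hfix]) fun b hb => ?_
    have : {x | (σ ∘ f) x = b} = {x | f x = f b} := by
      ext x
      change σ (f x) = b ↔ f x = f b
      rw [← hb]
      simp [hσ, hσi.eq_iff]
    rw [this]
    exact hfib _
  -- The index `none` stands for the central piece `Set.range σ`, and `some l` for the fibre over
  -- `l`, which meets the central piece in `σ l` only.
  rw [h𝒢.mem_iff_pieces hG (ι := Option L)
    (fun o => o.elim (Set.range σ) fun l => Set.range (Subtype.val : {v // f v = l} → V))]
  · rw [Option.forall]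
    refine and_congr ?_ (forall_congr' fun l => ?_)
    · exact GraphClass.mem_comap_congr G Subtype.val_injective hσi Subtype.range_coe
    · exact GraphClass.mem_comap_congr G Subtype.val_injective Subtype.val_injective
        Subtype.range_coe
  · rintro (_ | l)
    · exact hrange
    · simpa only [Option.elim, range_val_fiber] using hfib l
  · rintro (_ | l) (_ | l') hne x ⟨hx, hx'⟩ y ⟨hy, hy'⟩ <;>
      simp only [Option.elim, range_val_fiber, Set.mem_ofPred_eq, Set.mem_range] at *
    · exact absurd rfl hne
    · obtain ⟨a, rfl⟩ := hx
      obtain ⟨b, rfl⟩ := hy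
      rw [← hσ a, ← hσ b, hx', hy']
    · obtain ⟨a, rfl⟩ := hx'
      obtain ⟨b, rfl⟩ := hy'
      rw [← hσ a, ← hσ b, hx, hy]
    · exact absurd (by rw [← hx, hx']) hne
  · intro Y hY
    rcases TwoConn.subset_or_subset hidem hedge hY with h | ⟨b, hb⟩
    · exact ⟨none, fun y hy => ⟨f y, h y hy⟩⟩
    · refine ⟨some (f b), fun y hy => ?_⟩
      simp only [Option.elim, range_val_fiber]
      exact hσi (hb y hy)

end Membership

end BlockEGF

namespace BlockEGF

/-! ### Vertex types and the coloured graphs that are counted -/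

section VertexType

variable {V W : Type*}

theorem vertexType_eq_zero_iff {G : SimpleGraph V} {J : Set V} {v : V} :
    vertexType G J v = 0 ↔ v ∈ J := by
  unfold vertexType
  split_ifs <;> simp_all

theorem vertexType_eq_one_iff {G : SimpleGraph V} {J : Set V} {v : V} :
    vertexType G J v = 1 ↔ v ∉ J ∧ ∃ u ∈ J, G.Adj u v := by
  unfold vertexType
  split_ifs <;> simp_all

theorem vertexType_eq_two_iff {G : SimpleGraph V} {J : Set V} {v : V} :
    vertexType G J v = 2 ↔ v ∉ J ∧ ¬ ∃ u ∈ J, G.Adj u v := by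
  unfold vertexType
  split_ifs <;> simp_all

theorem vertexType_le_two (G : SimpleGraph V) (J : Set V) (v : V) : vertexType G J v ≤ 2 := by
  unfold vertexType
  split_ifs <;> simp

theorem vertexType_comap (e : V ≃ W) (G : SimpleGraph W) (J : Set W) (v : V) :
    vertexType (G.comap e) (e ⁻¹' J) v = vertexType G J (e v) := by
  have : (∃ u ∈ e ⁻¹' J, (G.comap e).Adj u v) ↔ ∃ u ∈ J, G.Adj u (e v) :=
    ⟨fun ⟨u, hu, h⟩ => ⟨e u, hu, h⟩,
      fun ⟨u, hu, h⟩ => ⟨e.symm u, by simpa using hu, by simpa using h⟩⟩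
  unfold vertexType
  rw [propext this]
  rfl

theorem isIndepSet_comap (e : V ≃ W) (G : SimpleGraph W) (J : Set W) :
    (G.comap e).IsIndepSet (e ⁻¹' J) ↔ G.IsIndepSet J := by
  constructor
  · intro h a ha b hb hab
    have := h (x := e.symm a) (by simpa using ha) (y := e.symm b) (by simpa using hb)
      (by simpa using hab)
    simpa using this
  · intro h a ha b hb hab
    exact h ha hb fun h => hab (e.injective h)

/-- `J` is independent, the root has a type in `T`, and every other vertex has type `0` or `1`. -/
def IsDominatedExcept (G : SimpleGraph V) (J : Set V) (r : V) (T : Set ℕ) : Prop :=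
  G.IsIndepSet J ∧ vertexType G J r ∈ T ∧ ∀ v, v ≠ r → vertexType G J v ≠ 2

/-- Connected graphs of the class on the vertex set `V` with root `r`, coloured by an independent
set that dominates all vertices but the root, whose type is in `T`. -/
def GraphClass.rooted (𝒢 : GraphClass) (r : V) (T : Set ℕ) : Set (SimpleGraph V × Set V) :=
  {q | 𝒢.Mem q.1 ∧ q.1.Connected ∧ IsDominatedExcept q.1 q.2 r T}

/-- 2-connected graphs of the class on the vertex set `V` with root `r`, coloured by an
independent set, with root of type in `T`. -/
def GraphClass.rootedBlock (𝒢 : GraphClass) (r : V) (T : Set ℕ) : Set (SimpleGraph V × Set V) :=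
  {q | 𝒢.Mem q.1 ∧ IsTwoConnected q.1 ∧ q.1.IsIndepSet q.2 ∧ vertexType q.1 q.2 r ∈ T}

/-- The types that the root of the graph hanging at a non-root vertex of a block may have, in terms
of the type of this vertex in the block. -/
def hangingTypes (t : ℕ) : Set ℕ := if t = 0 then {0} else if t = 1 then {1, 2} else {1}

/-- A set of types for the root that is preserved under gluing at the root. -/
def IsGlueable (T : Set ℕ) : Prop := T = {0} ∨ T = {1, 2} ∨ T = {2}

end VertexType

/-! ### Splitting a coloured graph into a block and its hanging pieces, and gluing -/

section Splitting

variable {V L : Type*} {G : SimpleGraph V} {J : Set V} {f : V → L} {σ : L → V}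

theorem exists_adj_iff_of_split (hσ : ∀ l, f (σ l) = l) (hedge : EdgesSplit G (σ ∘ f) Set.univ)
    {l : L} (v : {v // f v = l}) :
    (∃ u ∈ J, G.Adj u v) ↔
      (∃ u ∈ (Subtype.val ⁻¹' J : Set {v // f v = l}), (G.comap Subtype.val).Adj u v) ∨
      (σ l = v ∧ ∃ u ∈ σ ⁻¹' J, (G.comap σ).Adj u l) := by
  obtain ⟨v, rfl⟩ := v
  have hσi : Function.Injective σ := Function.LeftInverse.injective hσ
  constructor
  · rintro ⟨u, hu, huv⟩
    rcases hedge u trivial v trivial huv with h | h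
    · exact Or.inl ⟨⟨u, hσi h⟩, hu, huv⟩
    · refine Or.inr ⟨h.2, f u, ?_, ?_⟩
      · rw [Set.mem_preimage, show σ (f u) = u from h.1]
        exact hu
      · rw [SimpleGraph.comap_adj, show σ (f u) = u from h.1, show σ (f v) = v from h.2]
        exact huv
  · rintro (⟨u, hu, huv⟩ | ⟨h, u, hu, huv⟩)
    · exact ⟨u, hu, huv⟩
    · refine ⟨σ u, hu, ?_⟩
      rw [SimpleGraph.comap_adj, h] at huv
      exact huv

theorem isIndepSet_iff_of_split (hσ : ∀ l, f (σ l) = l)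
    (hedge : EdgesSplit G (σ ∘ f) Set.univ) :
    G.IsIndepSet J ↔ (G.comap σ).IsIndepSet (σ ⁻¹' J) ∧
      ∀ l, (G.comap (Subtype.val : {v // f v = l} → V)).IsIndepSet (Subtype.val ⁻¹' J) := by
  have hσi : Function.Injective σ := Function.LeftInverse.injective hσ
  constructor
  · intro h
    exact ⟨fun a ha b hb hab => h ha hb fun h => hab (hσi h),
      fun l a ha b hb hab => h ha hb fun h => hab (Subtype.ext h)⟩
  · rintro ⟨h₁, h₂⟩ a ha b hb hab hadj
    rcases hedge a trivial b trivial hadj with h | h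
    · exact h₂ (f b) (x := ⟨a, hσi h⟩) ha (y := ⟨b, rfl⟩) hb (fun h => hab (congrArg Subtype.val h))
        hadj
    · have ha' : σ (f a) = a := h.1
      have hb' : σ (f b) = b := h.2
      refine h₁ (x := f a) (by rwa [Set.mem_preimage, ha']) (y := f b)
        (by rwa [Set.mem_preimage, hb']) (fun h => hab (by rw [← ha', ← hb', h])) ?_
      rwa [SimpleGraph.comap_adj, ha', hb']

/-- The neighbours in `J` of a block vertex lie in the block or in the piece hanging there, so its
type in `G` is the minimum of its types in the two. `hangingTypes` lists the piece types for which
this minimum is not 2. At the root the minimum must lie in `T`; as the two types are both 0 or both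
positive, for glueable `T` this means that both lie in `T`. For `T = {1}` it would fail, with types
1 and 2. -/
theorem isDominatedExcept_iff_of_split [DecidableEq L] (hσ : ∀ l, f (σ l) = l)
    (hedge : EdgesSplit G (σ ∘ f) Set.univ) (l₀ : L) {T : Set ℕ} (hT : IsGlueable T) :
    IsDominatedExcept G J (σ l₀) T ↔
      ((G.comap σ).IsIndepSet (σ ⁻¹' J) ∧ vertexType (G.comap σ) (σ ⁻¹' J) l₀ ∈ T) ∧
      ∀ l, IsDominatedExcept (G.comap (Subtype.val : {v // f v = l} → V)) (Subtype.val ⁻¹' J)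
        ⟨σ l, hσ l⟩
        (if l = l₀ then T else hangingTypes (vertexType (G.comap σ) (σ ⁻¹' J) l)) := by
  classical
  have hne : ∀ (l : L) (v : {v // f v = l}), v ≠ ⟨σ l, hσ l⟩ →
      vertexType G J v = vertexType (G.comap Subtype.val) (Subtype.val ⁻¹' J) v := by
    intro l v hv
    have : σ l ≠ v := fun h => hv (Subtype.ext h.symm)
    unfold vertexType
    simp only [exists_adj_iff_of_split hσ hedge v, this, false_and, or_false]
    rfl
  have hroot : vertexType G J (σ l₀) ∈ T ↔ vertexType (G.comap σ) (σ ⁻¹' J) l₀ ∈ T ∧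
      vertexType (G.comap (Subtype.val : {v // f v = l₀} → V)) (Subtype.val ⁻¹' J)
        ⟨σ l₀, hσ l₀⟩ ∈ T := by
    have := exists_adj_iff_of_split (J := J) hσ hedge ⟨σ l₀, hσ l₀⟩
    have h₁ : l₀ ∈ σ ⁻¹' J ↔ σ l₀ ∈ J := Iff.rfl
    have h₂ : (⟨σ l₀, hσ l₀⟩ : {v // f v = l₀}) ∈ (Subtype.val ⁻¹' J : Set {v // f v = l₀}) ↔
      σ l₀ ∈ J := Iff.rfl
    simp only [true_and] at this
    rcases hT with rfl | rfl | rfl <;>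
      simp only [Set.mem_singleton_iff, Set.mem_insert_iff, vertexType_eq_zero_iff,
        vertexType_eq_one_iff, vertexType_eq_two_iff, this, h₁, h₂] <;> grind
  have hinner : ∀ l, vertexType G J (σ l) ≠ 2 ↔
      vertexType (G.comap (Subtype.val : {v // f v = l} → V)) (Subtype.val ⁻¹' J) ⟨σ l, hσ l⟩ ∈
        hangingTypes (vertexType (G.comap σ) (σ ⁻¹' J) l) := by
    intro l
    have := exists_adj_iff_of_split (J := J) hσ hedge ⟨σ l, hσ l⟩
    have h₁ : l ∈ σ ⁻¹' J ↔ σ l ∈ J := Iff.rfl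
    have h₂ : (⟨σ l, hσ l⟩ : {v // f v = l}) ∈ (Subtype.val ⁻¹' J : Set {v // f v = l}) ↔
      σ l ∈ J := Iff.rfl
    simp only [true_and] at this
    unfold hangingTypes
    simp only [Ne, vertexType_eq_zero_iff, vertexType_eq_one_iff, vertexType_eq_two_iff, this, h₁]
    split_ifs <;> simp only [Set.mem_singleton_iff, Set.mem_insert_iff, vertexType_eq_zero_iff,
      vertexType_eq_one_iff, vertexType_eq_two_iff, h₂] <;> grind
  unfold IsDominatedExcept
  rw [isIndepSet_iff_of_split hσ hedge, hroot]
  constructor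
  · rintro ⟨⟨h₁, h₂⟩, ⟨h₃, h₄⟩, h₅⟩
    refine ⟨⟨h₁, h₃⟩, fun l => ⟨h₂ l, ?_, fun v hv => ?_⟩⟩
    · split_ifs with hl
      · subst hl
        exact h₄
      · exact (hinner l).mp (h₅ _ fun h => hl (by rw [← hσ l, h, hσ]))
    · rw [← hne l v hv]
      refine h₅ v fun h => hv ?_
      have hl : l = l₀ := by rw [← v.2, h, hσ]
      subst hl
      exact Subtype.ext h
  · rintro ⟨⟨h₁, h₃⟩, h⟩
    refine ⟨⟨h₁, fun l => (h l).1⟩, ⟨h₃, by simpa using (h l₀).2.1⟩, fun v hv => ?_⟩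
    by_cases hv' : σ (f v) = v
    · have hl : f v ≠ l₀ := fun h => hv (by rw [← hv', h])
      have := (h (f v)).2.1
      rw [if_neg hl, ← hinner, hv'] at this
      exact this
    · have hv'' : (⟨v, rfl⟩ : {w // f w = f v}) ≠ ⟨σ (f v), hσ _⟩ :=
        fun h => hv' (congrArg Subtype.val h).symm
      have := (h (f v)).2.2 ⟨v, rfl⟩ hv''
      rwa [← hne (f v) ⟨v, rfl⟩ hv''] at this

/-- Membership, connectedness and domination each separate into a condition on the block and one on
every piece. The retraction on the left supplies what rootedness alone does not: that the image of
`σ` is 2-connected and the fibres are connected. -/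
theorem GraphClass.BlockStable.mem_rooted_iff [Finite V] [DecidableEq L]
    {𝒢 : GraphClass} (h𝒢 : 𝒢.BlockStable) (hσ : ∀ l, f (σ l) = l)
    (hedge : EdgesSplit G (σ ∘ f) Set.univ) (l₀ : L) {T : Set ℕ} (hT : IsGlueable T) :
    ((G, J) ∈ 𝒢.rooted (σ l₀) T ∧ IsRetraction G (σ ∘ f) Set.univ) ↔
      (G.comap σ, σ ⁻¹' J) ∈ 𝒢.rootedBlock l₀ T ∧
      ∀ l, (G.comap Subtype.val, Subtype.val ⁻¹' J) ∈ 𝒢.rooted (⟨σ l, hσ l⟩ : {v // f v = l})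
        (if l = l₀ then T else hangingTypes (vertexType (G.comap σ) (σ ⁻¹' J) l)) := by
  have hσi : Function.Injective σ := Function.LeftInverse.injective hσ
  have hfix : {x ∈ Set.univ | (σ ∘ f) x = x} = Set.range σ := by
    ext x
    simp only [Set.mem_univ, true_and]
    exact ⟨fun h => ⟨f x, h⟩, by rintro ⟨l, rfl⟩; simp [hσ]⟩
  have hfib : ∀ l, {x ∈ Set.univ | (σ ∘ f) x = σ l} = {v | f v = l} := fun l => by
    ext x
    simp [hσi.eq_iff]
  have hret : IsRetraction G (σ ∘ f) Set.univ ↔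
      TwoConn G (Set.range σ) ∧ ∀ l, Conn G {v | f v = l} := by
    constructor
    · intro h
      refine ⟨hfix ▸ h.twoConn, fun l => ?_⟩
      rw [← hfib]
      exact h.conn _ trivial (by simp [hσ])
    · rintro ⟨h₁, h₂⟩
      refine ⟨fun x _ => trivial, fun x _ => by simp [hσ], hedge, fun b _ hb => ?_, ?_⟩
      · rw [← hb]
        change Conn G {x ∈ Set.univ | (σ ∘ f) x = σ (f b)}
        rw [hfib]
        exact h₂ _
      · rwa [hfix]
  have hidem : ∀ x, (σ ∘ f) ((σ ∘ f) x) = (σ ∘ f) x := fun x => by simp [hσ]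
  unfold GraphClass.rooted GraphClass.rootedBlock
  simp only [Set.mem_ofPred_eq]
  rw [hret, isDominatedExcept_iff_of_split hσ hedge l₀ hT, isTwoConnected_comap_iff G σ hσi]
  simp only [connected_comap_iff G _ Subtype.val_injective, range_val_fiber]
  constructor
  · rintro ⟨⟨hmem, hconn, hdom⟩, h2, hc⟩
    rw [h𝒢.mem_iff_section hσ hedge h2.2.1 hc] at hmem
    exact ⟨⟨hmem.1, h2, hdom.1⟩, fun l => ⟨hmem.2 l, hc l, hdom.2 l⟩⟩
  · rintro ⟨⟨hmem, h2, hdom⟩, h⟩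
    have hc := fun l => (h l).2.1
    refine ⟨⟨(h𝒢.mem_iff_section hσ hedge h2.2.1 hc).mpr ⟨hmem, fun l => (h l).1⟩, ?_, hdom,
      fun l => (h l).2.2⟩, h2, hc⟩
    rw [connected_iff_conn_univ]
    refine conn_univ_of_fibers hidem ?_ fun b hb => ?_
    · simpa [← hfix] using h2.2.1
    · have := hfib (f b)
      rw [show σ (f b) = b from hb] at this
      simp only [Set.mem_univ, true_and] at this
      rw [this]
      exact hc _

/-- A graph that splits is determined by its pieces. -/
theorem eq_of_comap_eq (hσ : ∀ l, f (σ l) = l) {H : SimpleGraph V}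
    (hG : EdgesSplit G (σ ∘ f) Set.univ) (hH : EdgesSplit H (σ ∘ f) Set.univ)
    (hb : G.comap σ = H.comap σ)
    (hl : ∀ l, G.comap (Subtype.val : {v // f v = l} → V) = H.comap Subtype.val) : G = H := by
  have key : ∀ {G H : SimpleGraph V}, EdgesSplit G (σ ∘ f) Set.univ → G.comap σ = H.comap σ →
      (∀ l, G.comap (Subtype.val : {v // f v = l} → V) = H.comap Subtype.val) → G ≤ H := by
    intro G H hG hb hl u v huv
    rcases hG u trivial v trivial huv with h | h
    · have huv' : (G.comap (Subtype.val : {w // f w = f v} → V)).Adj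
        ⟨u, Function.LeftInverse.injective hσ h⟩ ⟨v, rfl⟩ := huv
      rw [hl] at huv'
      exact huv'
    · have huv' : (G.comap σ).Adj (f u) (f v) := by
        rwa [SimpleGraph.comap_adj, show σ (f u) = u from h.1, show σ (f v) = v from h.2]
      rwa [hb, SimpleGraph.comap_adj, show σ (f u) = u from h.1, show σ (f v) = v from h.2] at huv'
  exact le_antisymm (key hG hb hl) (key hH hb.symm fun l => (hl l).symm)

/-- Pieces can be glued. -/
theorem exists_glue (hσ : ∀ l, f (σ l) = l) (B : SimpleGraph L)
    (g : ∀ l, SimpleGraph {v // f v = l}) :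
    ∃ G : SimpleGraph V, EdgesSplit G (σ ∘ f) Set.univ ∧ G.comap σ = B ∧
      ∀ l, G.comap Subtype.val = g l := by
  have hσi : Function.Injective σ := Function.LeftInverse.injective hσ
  refine ⟨B.map σ ⊔ ⨆ l, (g l).map Subtype.val, ?_, ?_, ?_⟩
  · intro u _ v _ huv
    simp only [SimpleGraph.sup_adj, SimpleGraph.iSup_adj, SimpleGraph.map_adj'] at huv
    rcases huv with ⟨_, a, b, _, rfl, rfl⟩ | ⟨l, _, a, b, _, rfl, rfl⟩
    · exact Or.inr (by simp [hσ])
    · exact Or.inl (by simp [a.2, b.2])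
  · ext a b
    simp only [SimpleGraph.comap_adj, SimpleGraph.sup_adj, SimpleGraph.iSup_adj,
      SimpleGraph.map_adj']
    constructor
    · rintro (⟨_, a', b', h, ha, hb⟩ | ⟨l, hne, a', b', h, ha, hb⟩)
      · rwa [hσi ha, hσi hb] at h
      · refine absurd ?_ hne
        rw [← hσ a, ← hσ b, ← ha, ← hb, a'.2, b'.2]
    · exact fun h => Or.inl ⟨fun h' => h.ne (hσi h'), a, b, h, rfl, rfl⟩
  · intro l
    ext a b
    simp only [SimpleGraph.comap_adj, SimpleGraph.sup_adj, SimpleGraph.iSup_adj,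
      SimpleGraph.map_adj']
    constructor
    · rintro (⟨hne, a', b', h, ha, hb⟩ | ⟨l', _, a', b', h, ha, hb⟩)
      · refine absurd ?_ hne
        rw [← ha, ← hb, ← hσ a', ← hσ b', ha, hb, a.2, b.2]
      · obtain rfl : l' = l := by rw [← a'.2, ha, a.2]
        rwa [Subtype.ext ha, Subtype.ext hb] at h
    · exact fun h => Or.inr ⟨l, fun h' => h.ne (Subtype.ext h'), a, b, h, rfl, rfl⟩

end Splitting

end BlockEGF

namespace BlockEGF

open Finset

/-! ### Weighted sums over coloured rooted graphs -/

section Sums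

variable {R : Type*} [CommRing R]

open Classical in
/-- The monomial of a set `J` on a vertex set with root `r`: `y 0` for every vertex of `J` and
`y 1` for every other vertex, where the root is discounted. -/
noncomputable def weight {V : Type*} [Fintype V] (y : Fin 2 → R) (J : Set V) (r : V) : R :=
  ∏ v, if v = r then 1 else if v ∈ J then y 0 else y 1

/-- The total weight of the coloured graphs of the class on `V` with root `r` of type in `T`. -/
noncomputable def GraphClass.rootedSum (𝒢 : GraphClass) {V : Type*} [Fintype V] (y : Fin 2 → R)
    (r : V) (T : Set ℕ) : R :=
  ∑ q ∈ (Set.toFinite (𝒢.rooted r T)).toFinset, weight y q.2 r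

/-- The total weight of the coloured graphs with `n + 1` vertices. -/
noncomputable def GraphClass.rootedCoeff (𝒢 : GraphClass) (y : Fin 2 → R) (T : Set ℕ) (n : ℕ) : R :=
  𝒢.rootedSum y (Fin.last n) T

theorem weight_comap {V W : Type*} [Fintype V] [Fintype W] (y : Fin 2 → R) (e : V ≃ W)
    (J : Set W) (r : V) : weight y (e ⁻¹' J) r = weight y J (e r) := by
  classical
  unfold weight
  refine Fintype.prod_equiv e _ _ fun v => ?_
  simp

theorem GraphClass.rooted_comap (𝒢 : GraphClass) {V W : Type*} (e : V ≃ W) (r : V) (T : Set ℕ)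
    (G : SimpleGraph W) (J : Set W) :
    (G.comap e, e ⁻¹' J) ∈ 𝒢.rooted r T ↔ (G, J) ∈ 𝒢.rooted (e r) T := by
  unfold GraphClass.rooted IsDominatedExcept
  simp only [Set.mem_ofPred_eq, vertexType_comap, isIndepSet_comap]
  rw [GraphClass.mem_iff_of_iso (SimpleGraph.Iso.comap e G),
    (SimpleGraph.Iso.comap e G).connected_iff, ← e.forall_congr_right (q := fun v =>
      v ≠ e r → vertexType G J v ≠ 2)]
  simp

theorem GraphClass.rootedBlock_comap (𝒢 : GraphClass) {V W : Type*} (e : V ≃ W) (r : V)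
    (T : Set ℕ) (G : SimpleGraph W) (J : Set W) :
    (G.comap e, e ⁻¹' J) ∈ 𝒢.rootedBlock r T ↔ (G, J) ∈ 𝒢.rootedBlock (e r) T := by
  unfold GraphClass.rootedBlock
  simp only [Set.mem_ofPred_eq, vertexType_comap, isIndepSet_comap]
  rw [GraphClass.mem_iff_of_iso (SimpleGraph.Iso.comap e G),
    isTwoConnected_comap_iff G e e.injective, e.surjective.range_eq, ← isTwoConnected_iff]

/-- Relabelling coloured graphs. -/
def colouredEquiv {V W : Type*} (e : V ≃ W) :
    (SimpleGraph W × Set W) ≃ (SimpleGraph V × Set V) where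
  toFun q := (q.1.comap e, e ⁻¹' q.2)
  invFun q := (q.1.comap e.symm, e.symm ⁻¹' q.2)
  left_inv q := by
    ext <;> simp
  right_inv q := by
    ext <;> simp

theorem GraphClass.rootedSum_eq_of_equiv (𝒢 : GraphClass) {V W : Type*} [Fintype V] [Fintype W]
    (y : Fin 2 → R) (e : V ≃ W) (r : V) (T : Set ℕ) :
    𝒢.rootedSum y (e r) T = 𝒢.rootedSum y r T := by
  unfold GraphClass.rootedSum
  refine Finset.sum_equiv (colouredEquiv e) (fun q => ?_) fun q _ => ?_
  · simp only [Set.Finite.mem_toFinset]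
    exact (𝒢.rooted_comap e r T q.1 q.2).symm
  · exact (weight_comap y e q.2 r).symm

theorem GraphClass.rootedSum_eq_rootedCoeff (𝒢 : GraphClass) {V : Type*} [Fintype V]
    (y : Fin 2 → R) (r : V) (T : Set ℕ) :
    𝒢.rootedSum y r T = 𝒢.rootedCoeff y T (Fintype.card V - 1) := by
  classical
  have hpos : 0 < Fintype.card V := Fintype.card_pos_iff.mpr ⟨r⟩
  obtain ⟨e⟩ : Nonempty (V ≃ Fin (Fintype.card V - 1 + 1)) :=
    Fintype.card_eq.mp (by rw [Fintype.card_fin]; omega)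
  let e' := e.trans (Equiv.swap (e r) (Fin.last _))
  have : e' r = Fin.last _ := by simp [e']
  unfold GraphClass.rootedCoeff
  rw [← this, 𝒢.rootedSum_eq_of_equiv]

-- The root of each piece is discounted there and counted once in the block, except for `l₀`, which
-- is discounted in both.
open Classical in
theorem weight_split {V L : Type*} [Fintype V] [Fintype L] [DecidableEq L]
    (y : Fin 2 → R) {f : V → L} {σ : L → V} (hσ : ∀ l, f (σ l) = l) (l₀ : L) (J : Set V) :
    weight y J (σ l₀) = weight y (σ ⁻¹' J) l₀ *
      ∏ l, weight y (Subtype.val ⁻¹' J : Set {v // f v = l}) ⟨σ l, hσ l⟩ := by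
  unfold weight
  rw [← Fintype.prod_fiberwise f, ← Finset.prod_mul_distrib]
  refine Finset.prod_congr rfl fun l _ => ?_
  rw [Fintype.prod_eq_mul_prod_compl (⟨σ l, hσ l⟩ : {v // f v = l}),
    Fintype.prod_eq_mul_prod_compl (⟨σ l, hσ l⟩ : {v // f v = l}), if_pos rfl, one_mul]
  have hσi : Function.Injective σ := Function.LeftInverse.injective hσ
  congr 1
  · simp [hσi.eq_iff]
  · refine Finset.prod_congr rfl fun v hv => ?_
    have hv' : v ≠ ⟨σ l, hσ l⟩ := by simpa using hv
    have : (v : V) ≠ σ l₀ := by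
      intro h
      apply hv'
      have hl : l = l₀ := by rw [← v.2, h, hσ]
      subst hl
      exact Subtype.ext h
    rw [if_neg hv', if_neg this]
    rfl

/-- Types of the root of the piece at `l`, given the coloured block `c` with root `l₀`. -/
noncomputable def pieceTypes {L : Type*} [DecidableEq L] (T : Set ℕ) (l₀ : L)
    (c : SimpleGraph L × Set L) (l : L) : Set ℕ :=
  if l = l₀ then T else hangingTypes (vertexType c.1 c.2 l)

/-- The admissible types are 0 in the block exactly when they are 0 in the piece. Block and piece
thus agree on the colour of their common vertex, and gluing needs no extra compatibility condition.
-/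
theorem mem_iff_of_pieceTypes {L V : Type*} [DecidableEq L] {𝒢 : GraphClass} {T : Set ℕ}
    (hT : IsGlueable T) {l₀ l : L}
    {c : SimpleGraph L × Set L} (hc : c ∈ 𝒢.rootedBlock l₀ T) {r : V} {q : SimpleGraph V × Set V}
    (hq : q ∈ 𝒢.rooted r (pieceTypes T l₀ c l)) : l ∈ c.2 ↔ r ∈ q.2 := by
  have h₁ := hc.2.2.2
  have h₂ := hq.2.2.2.1
  rw [← vertexType_eq_zero_iff (G := c.1), ← vertexType_eq_zero_iff (G := q.1)]
  unfold pieceTypes hangingTypes at h₂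
  split_ifs at h₂ with hl h0 h1
  · subst hl
    rcases hT with rfl | rfl | rfl <;>
      simp only [Set.mem_singleton_iff, Set.mem_insert_iff] at h₁ h₂ <;> omega
  all_goals
    simp only [Set.mem_singleton_iff, Set.mem_insert_iff] at h₂
    omega

open Classical in
/-- The coloured graphs that split along a given section correspond to families of pieces. -/
theorem GraphClass.BlockStable.sum_split {𝒢 : GraphClass} (h𝒢 : 𝒢.BlockStable) {V L : Type*}
    [Fintype V] [Fintype L] [DecidableEq L] (y : Fin 2 → R) {f : V → L} {σ : L → V}
    (hσ : ∀ l, f (σ l) = l)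
    (l₀ : L) {T : Set ℕ} (hT : IsGlueable T) :
    ∑ q ∈ (Set.toFinite (𝒢.rooted (σ l₀) T)).toFinset with IsRetraction q.1 (σ ∘ f) Set.univ,
        weight y q.2 (σ l₀) =
      ∑ c ∈ (Set.toFinite (𝒢.rootedBlock l₀ T)).toFinset, weight y c.2 l₀ *
        ∏ l, 𝒢.rootedCoeff y (pieceTypes T l₀ c l) (Fintype.card {v // f v = l} - 1) := by
  -- Expanding the product of sums turns the right-hand side into a sum over a block together with
  -- one coloured graph for each piece.
  have hexp : ∀ c : SimpleGraph L × Set L, weight y c.2 l₀ *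
        ∏ l, 𝒢.rootedCoeff y (pieceTypes T l₀ c l) (Fintype.card {v // f v = l} - 1) =
      ∑ h ∈ Fintype.piFinset fun l => (Set.toFinite (𝒢.rooted (⟨σ l, hσ l⟩ : {v // f v = l})
          (pieceTypes T l₀ c l))).toFinset,
        weight y c.2 l₀ * ∏ l, weight y (h l).2 ⟨σ l, hσ l⟩ := by
    intro c
    rw [← Finset.mul_sum, ← Finset.prod_univ_sum _ fun l (x : SimpleGraph {v // f v = l} ×
      Set {v // f v = l}) => weight y x.2 ⟨σ l, hσ l⟩]
    congr 1
    refine Finset.prod_congr rfl fun l _ => ?_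
    rw [← 𝒢.rootedSum_eq_rootedCoeff y (⟨σ l, hσ l⟩ : {v // f v = l})]
    rfl
  simp_rw [hexp]
  rw [Finset.sum_sigma']
  have hmem : ∀ q : SimpleGraph V × Set V, EdgesSplit q.1 (σ ∘ f) Set.univ →
      ((q ∈ 𝒢.rooted (σ l₀) T ∧ IsRetraction q.1 (σ ∘ f) Set.univ) ↔
        (q.1.comap σ, σ ⁻¹' q.2) ∈ 𝒢.rootedBlock l₀ T ∧
        ∀ l, (q.1.comap Subtype.val, Subtype.val ⁻¹' q.2) ∈
          𝒢.rooted (⟨σ l, hσ l⟩ : {v // f v = l})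
            (pieceTypes T l₀ (q.1.comap σ, σ ⁻¹' q.2) l)) :=
    fun q hq => h𝒢.mem_rooted_iff hσ hq l₀ hT
  refine Finset.sum_bij (fun q _ => ⟨(q.1.comap σ, σ ⁻¹' q.2),
    fun l => (q.1.comap Subtype.val, Subtype.val ⁻¹' q.2)⟩) ?_ ?_ ?_ ?_
  · intro q hq
    simp only [Finset.mem_filter, Set.Finite.mem_toFinset] at hq
    simp only [Finset.mem_sigma, Fintype.mem_piFinset, Set.Finite.mem_toFinset]
    exact (hmem q hq.2.edges).mp hq
  · rintro ⟨G, J⟩ hq ⟨H, K⟩ hq' heq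
    simp only [Finset.mem_filter, Set.Finite.mem_toFinset] at hq hq'
    rw [Sigma.mk.injEq, heq_eq_eq, Prod.mk.injEq, funext_iff] at heq
    obtain ⟨⟨hb, -⟩, hl⟩ := heq
    simp only [Prod.mk.injEq] at hl
    refine Prod.ext (eq_of_comap_eq hσ hq.2.edges hq'.2.edges hb fun l => (hl l).1) ?_
    ext v
    have := congrArg (fun S : Set {w // f w = f v} => ⟨v, rfl⟩ ∈ S) (hl (f v)).2
    exact iff_of_eq this
  · rintro ⟨c, h⟩ hch
    simp only [Finset.mem_sigma, Fintype.mem_piFinset, Set.Finite.mem_toFinset] at hch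
    obtain ⟨G, hedge, hb, hl⟩ := exists_glue hσ c.1 fun l => (h l).1
    -- The pieces alone determine the colouring, since every vertex lies in exactly one fibre.
    let J : Set V := {v | (⟨v, rfl⟩ : {w // f w = f v}) ∈ (h (f v)).2}
    have hJl : ∀ l, (Subtype.val ⁻¹' J : Set {v // f v = l}) = (h l).2 := by
      intro l
      ext ⟨v, rfl⟩
      rfl
    have hJb : σ ⁻¹' J = c.2 := by
      ext l
      rw [mem_iff_of_pieceTypes hT hch.1 (hch.2 l), ← hJl]
      rfl
    have hc : (G.comap σ, σ ⁻¹' J) = c := Prod.ext hb hJb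
    have hh : (fun l => ((G.comap Subtype.val, Subtype.val ⁻¹' J) :
        SimpleGraph {v // f v = l} × Set {v // f v = l})) = h :=
      funext fun l => Prod.ext (hl l) (hJl l)
    refine ⟨(G, J), ?_, by rw [Sigma.mk.injEq, heq_eq_eq]; exact ⟨hc, hh⟩⟩
    simp only [Finset.mem_filter, Set.Finite.mem_toFinset]
    rw [hmem (G, J) hedge]
    simp only [hc]
    refine ⟨hch.1, fun l => ?_⟩
    have := congrFun hh l
    rw [this]
    exact hch.2 l
  · intro q hq
    exact weight_split y hσ l₀ q.2

end Sums

end BlockEGF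

namespace BlockEGF

open Finset

/-! ### Counting labelled retractions and summing over root and second vertex -/

section Counting

theorem card_sections {W L : Type*} [Fintype W] [Fintype L] [DecidableEq L] (f : W → L) :
    #{σ : L → W | ∀ l, f (σ l) = l} = ∏ l, #{v | f v = l} := by
  rw [← Fintype.card_piFinset]
  congr 1
  ext σ
  simp

variable {V : Type*} [Fintype V] [DecidableEq V]

-- A factorisation `p = σ ∘ f` with `f ∘ σ = id` amounts to a bijection from `Option (Fin k)` to the
-- image of `p`; the condition at `none` leaves a labelling of the block vertices other than `r`.
open Classical in
theorem card_section_of_retraction {p : V → V} (hp : ∀ x, p (p x) = p x) {r : V} (hr : p r = r)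
    (k : ℕ) :
    #{s : (V → Option (Fin k)) × (Option (Fin k) → V) |
      (∀ l, s.1 (s.2 l) = l) ∧ s.2 none = r ∧ s.2 ∘ s.1 = p} =
    if k = Fintype.card {x : Set.range p // x ≠ ⟨r, r, hr⟩} then k.factorial else 0 := by
  have h₁ : #{s : (V → Option (Fin k)) × (Option (Fin k) → V) |
      (∀ l, s.1 (s.2 l) = l) ∧ s.2 none = r ∧ s.2 ∘ s.1 = p} =
      Fintype.card {e : Option (Fin k) ≃ Set.range p // e none = ⟨r, r, hr⟩} := by
    rw [← Finset.card_univ]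
    symm
    refine Finset.card_bij (fun e _ => (fun v => e.1.symm ⟨p v, v, rfl⟩, fun l => (e.1 l : V)))
      ?_ ?_ ?_
    · rintro ⟨e, he⟩ -
      simp only [Finset.mem_filter, Finset.mem_univ, true_and, he]
      refine ⟨fun l => ?_, ?_⟩
      · rw [Equiv.symm_apply_eq]
        obtain ⟨x, hx⟩ := (e l).2
        exact Subtype.ext (by simp only [← hx, hp])
      · ext v
        simp
    · rintro ⟨e, he⟩ - ⟨e', he'⟩ - h
      rw [Prod.mk.injEq] at h
      exact Subtype.ext (Equiv.ext fun l => Subtype.ext (congrFun h.2 l))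
    · rintro ⟨f, σ⟩ h
      simp only [Finset.mem_filter, Finset.mem_univ, true_and] at h
      obtain ⟨h₁, h₂, rfl⟩ := h
      have hσf : ∀ x ∈ Set.range (σ ∘ f), σ (f x) = x := by
        rintro _ ⟨x, rfl⟩
        simp [h₁]
      refine ⟨⟨⟨fun l => ⟨σ l, σ l, by simp [h₁]⟩, fun x => f x, fun l => h₁ l,
        fun x => Subtype.ext (hσf x x.2)⟩, Subtype.ext h₂⟩, Finset.mem_univ _, ?_⟩
      refine Prod.ext (funext fun v => ?_) (funext fun l => rfl)
      exact h₁ _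
  rw [h₁, Fintype.card_congr (Equiv.optionSubtype _)]
  split_ifs with hk
  · obtain ⟨e⟩ : Nonempty (Fin k ≃ {x : Set.range p // x ≠ ⟨r, r, hr⟩}) :=
      Fintype.card_eq.mp (by simpa using hk)
    rw [Fintype.card_equiv e, Fintype.card_fin]
  · rw [Fintype.card_eq_zero_iff]
    exact ⟨fun e => hk (by simpa using Fintype.card_congr e)⟩

/-- Sections of maps onto a `k + 1` element set, pointed at `r`, that separate `r` from `w`. -/
def IsSection {k : ℕ} (r w : V) (s : (V → Option (Fin k)) × (Option (Fin k) → V)) : Prop :=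
  (∀ l, s.1 (s.2 l) = l) ∧ s.2 none = r ∧ s.1 w ≠ none

-- Only the unique retraction contributes. Its block, with `k` non-root vertices, has `k!`
-- labellings, which the factor `1 / k!` cancels.
open Classical in
theorem sum_card_section_eq_one {G : SimpleGraph V} (hG : G.Connected) {r w : V} (hrw : w ≠ r) :
    ∑ k ∈ range (Fintype.card V), (1 / (k.factorial : ℚ)) *
      #{s : (V → Option (Fin k)) × (Option (Fin k) → V) |
        IsSection r w s ∧ IsRetraction G (s.2 ∘ s.1) Set.univ} = 1 := by
  obtain ⟨p, hp, hpr, hpw⟩ := exists_isRetraction G Set.univ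
    ((connected_iff_conn_univ G).mp hG) (Set.mem_univ r) (Set.mem_univ w) hrw
  have hset : ∀ k, #{s : (V → Option (Fin k)) × (Option (Fin k) → V) |
        IsSection r w s ∧ IsRetraction G (s.2 ∘ s.1) Set.univ} =
      #{s : (V → Option (Fin k)) × (Option (Fin k) → V) |
        (∀ l, s.1 (s.2 l) = l) ∧ s.2 none = r ∧ s.2 ∘ s.1 = p} := by
    intro k
    congr 1
    refine Finset.filter_congr ?_
    rintro ⟨f, σ⟩ -
    constructor
    · rintro ⟨⟨h₁, h₂, h₃⟩, h₄⟩
      refine ⟨h₁, h₂, h₄.unique hp (r := r) (w := w) ?_ ?_ hpr hpw⟩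
      · rw [← h₂]
        exact congrArg σ (h₁ none)
      · intro h
        apply h₃
        exact (h₁ (f w)).symm.trans ((congrArg f (h.trans h₂.symm)).trans (h₁ none))
    · rintro ⟨h₁, h₂, rfl⟩
      refine ⟨⟨h₁, h₂, fun h => hpw ?_⟩, hp⟩
      exact (congrArg σ h).trans h₂
  simp_rw [hset, card_section_of_retraction (fun x => hp.idem x trivial) hpr]
  rw [Finset.sum_eq_single (Fintype.card {x : Set.range p // x ≠ ⟨r, r, hpr⟩})]
  · rw [if_pos rfl]
    have := Nat.factorial_ne_zero (Fintype.card {x : Set.range p // x ≠ ⟨r, r, hpr⟩})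
    field_simp
  · intro k _ hk
    rw [if_neg hk]
    simp
  · intro h
    refine absurd (Finset.mem_range.mpr ?_) h
    refine Fintype.card_lt_of_injective_of_notMem
      (fun x : {x : Set.range p // x ≠ ⟨r, r, hpr⟩} => (x.1.1 : V))
      (fun x y h => Subtype.ext (Subtype.ext h)) (b := r) ?_
    rintro ⟨x, hx⟩
    exact x.2 (Subtype.ext hx)

-- For a given `f`, the section is a choice of one point in each fibre and determines `r`; the
-- vertex `w` is any vertex outside the fibre of `none`, and is then automatically different from
-- `r`.
open Classical in
theorem sum_sections {M : Type*} [AddCommMonoid M] {k : ℕ} (Φ : (V → Option (Fin k)) → M) :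
    ∑ r : V, ∑ w with w ≠ r, ∑ s : (V → Option (Fin k)) × (Option (Fin k) → V) with
        IsSection r w s, Φ s.1 =
      ∑ f : V → Option (Fin k), (#{v | f v ≠ none} * ∏ l, #{v | f v = l}) • Φ f := by
  have h₁ : ∀ (r w : V) (f : V → Option (Fin k)) (σ : Option (Fin k) → V),
      (if w ≠ r then if IsSection r w (f, σ) then Φ f else 0 else 0) =
      if ∀ l, f (σ l) = l then if f w ≠ none then if r = σ none then Φ f else 0 else 0 else 0 := by
    intro r w f σ
    by_cases ha : ∀ l, f (σ l) = l
    · by_cases hb : f w ≠ none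
      · by_cases hc : r = σ none
        · have : w ≠ r := fun h => hb (by rw [h, hc, ha])
          rw [if_pos this, if_pos ⟨ha, hc.symm, hb⟩, if_pos ha, if_pos hb, if_pos hc]
        · have : ¬ IsSection r w (f, σ) := fun h => hc h.2.1.symm
          rw [if_neg this, if_pos ha, if_pos hb, if_neg hc, ite_self]
      · have : ¬ IsSection r w (f, σ) := fun h => hb h.2.2
        rw [if_neg this, if_pos ha, if_neg hb, ite_self]
    · have : ¬ IsSection r w (f, σ) := fun h => ha h.1
      rw [if_neg this, if_neg ha, ite_self]
  calc _ = ∑ r : V, ∑ w : V, ∑ f : V → Option (Fin k), ∑ σ : Option (Fin k) → V,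
        (if w ≠ r then if IsSection r w (f, σ) then Φ f else 0 else 0) := by
        refine Finset.sum_congr rfl fun r _ => ?_
        rw [Finset.sum_filter]
        refine Finset.sum_congr rfl fun w _ => ?_
        rw [Finset.sum_filter, Fintype.sum_prod_type]
        split_ifs
        · rfl
        · simp
    _ = ∑ f : V → Option (Fin k), ∑ σ : Option (Fin k) → V, ∑ w : V, ∑ r : V,
        (if ∀ l, f (σ l) = l then if f w ≠ none then if r = σ none then Φ f else 0 else 0
          else 0) := by
        simp_rw [h₁]
        rw [Finset.sum_comm]
        simp_rw [Finset.sum_comm (s := (univ : Finset V))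
            (t := (univ : Finset (V → Option (Fin k)))),
          Finset.sum_comm (s := (univ : Finset V)) (t := (univ : Finset (Option (Fin k) → V)))]
    _ = _ := by
        refine Finset.sum_congr rfl fun f _ => ?_
        rw [← card_sections, mul_comm, mul_smul, ← Finset.sum_const, Finset.sum_filter]
        refine Finset.sum_congr rfl fun σ _ => ?_
        split_ifs
        · rw [← Finset.sum_const, Finset.sum_filter]
          refine Finset.sum_congr rfl fun w _ => ?_
          split_ifs
          · simp
          · simp
        · simp

variable {R : Type*} [CommRing R] [Algebra ℚ R]

open Classical in
/-- Decomposition of all coloured graphs rooted at `r` along the block at `r` that leads to `w`. -/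
theorem GraphClass.BlockStable.rootedSum_eq {𝒢 : GraphClass} (h𝒢 : 𝒢.BlockStable)
    (y : Fin 2 → R) {T : Set ℕ} (hT : IsGlueable T) {r w : V} (hrw : w ≠ r) :
    𝒢.rootedSum y r T = ∑ k ∈ range (Fintype.card V), (1 / (k.factorial : ℚ)) •
      ∑ s : (V → Option (Fin k)) × (Option (Fin k) → V) with IsSection r w s,
        ∑ c ∈ (Set.toFinite (𝒢.rootedBlock (none : Option (Fin k)) T)).toFinset,
          weight y c.2 none * ∏ l, 𝒢.rootedCoeff y (pieceTypes T none c l)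
            (Fintype.card {v // s.1 v = l} - 1) := by
  have hsplit : ∀ (k : ℕ) (s : (V → Option (Fin k)) × (Option (Fin k) → V)), IsSection r w s →
      ∑ c ∈ (Set.toFinite (𝒢.rootedBlock (none : Option (Fin k)) T)).toFinset,
          weight y c.2 none * ∏ l, 𝒢.rootedCoeff y (pieceTypes T none c l)
            (Fintype.card {v // s.1 v = l} - 1) =
      ∑ q ∈ (Set.toFinite (𝒢.rooted r T)).toFinset,
        if IsRetraction q.1 (s.2 ∘ s.1) Set.univ then weight y q.2 r else 0 := by
    rintro k s ⟨h₁, rfl, -⟩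
    rw [← h𝒢.sum_split y h₁ none hT, Finset.sum_filter]
  have : ∀ k ∈ range (Fintype.card V), (1 / (k.factorial : ℚ)) •
      ∑ s : (V → Option (Fin k)) × (Option (Fin k) → V) with IsSection r w s,
        ∑ c ∈ (Set.toFinite (𝒢.rootedBlock (none : Option (Fin k)) T)).toFinset,
          weight y c.2 none * ∏ l, 𝒢.rootedCoeff y (pieceTypes T none c l)
            (Fintype.card {v // s.1 v = l} - 1) =
      ∑ q ∈ (Set.toFinite (𝒢.rooted r T)).toFinset, ((1 / (k.factorial : ℚ)) *
        #{s : (V → Option (Fin k)) × (Option (Fin k) → V) |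
        IsSection r w s ∧ IsRetraction q.1 (s.2 ∘ s.1) Set.univ}) • weight y q.2 r := by
    intro k _
    rw [Finset.sum_congr rfl fun s hs => hsplit k s (Finset.mem_filter.mp hs).2, Finset.sum_comm,
      Finset.smul_sum]
    refine Finset.sum_congr rfl fun q _ => ?_
    rw [← Finset.sum_filter, Finset.sum_const, Finset.filter_filter, mul_smul,
      Nat.cast_smul_eq_nsmul]
  rw [Finset.sum_congr rfl this, Finset.sum_comm]
  refine Finset.sum_congr rfl fun q hq => ?_
  rw [← Finset.sum_smul, sum_card_section_eq_one ((Set.Finite.mem_toFinset _).mp hq).2.1 hrw,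
    one_smul]

open Classical in
/-- The decomposition, summed over all roots and all other vertices. -/
theorem GraphClass.BlockStable.card_mul_rootedCoeff {𝒢 : GraphClass} (h𝒢 : 𝒢.BlockStable)
    (y : Fin 2 → R) {T : Set ℕ} (hT : IsGlueable T) (n : ℕ) :
    ((n * (n - 1) : ℕ) : R) * 𝒢.rootedCoeff y T (n - 1) =
      ∑ k ∈ range n, (1 / (k.factorial : ℚ)) •
      ∑ c ∈ (Set.toFinite (𝒢.rootedBlock (none : Option (Fin k)) T)).toFinset,
        weight y c.2 none * ∑ f : Fin n → Option (Fin k), (#{v | f v ≠ none} : R) *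
          ∏ l, (#{v | f v = l} : R) * 𝒢.rootedCoeff y (pieceTypes T none c l)
            (#{v | f v = l} - 1) := by
  -- The total weight does not depend on the root, and there are `n * (n - 1)` pairs `(r, w)`.
  have hlhs : ((n * (n - 1) : ℕ) : R) * 𝒢.rootedCoeff y T (n - 1) =
      ∑ r : Fin n, ∑ w : Fin n with w ≠ r, 𝒢.rootedSum y r T := by
    simp only [𝒢.rootedSum_eq_rootedCoeff, Finset.sum_const, Fintype.card_fin,
      Finset.filter_ne', Finset.card_erase_of_mem (Finset.mem_univ _), Finset.card_univ]
    rw [← mul_smul, nsmul_eq_mul]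
  rw [hlhs]
  have h₁ : ∀ r : Fin n, ∀ w ∈ ({w | w ≠ r} : Finset (Fin n)), 𝒢.rootedSum y r T = _ :=
    fun r w hw => h𝒢.rootedSum_eq y hT (Finset.mem_filter.mp hw).2
  rw [Finset.sum_congr rfl fun r _ => Finset.sum_congr rfl (h₁ r)]
  rw [Finset.sum_congr rfl fun r _ => Finset.sum_comm, Finset.sum_comm, Fintype.card_fin]
  refine Finset.sum_congr rfl fun k _ => ?_
  simp_rw [← Finset.smul_sum]
  congr 1
  rw [sum_sections fun f => ∑ c ∈ (Set.toFinite (𝒢.rootedBlock (none : Option (Fin k)) T)).toFinset,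
          weight y c.2 none * ∏ l, 𝒢.rootedCoeff y (pieceTypes T none c l)
            (Fintype.card {v // f v = l} - 1)]
  simp_rw [Finset.smul_sum]
  rw [Finset.sum_comm]
  refine Finset.sum_congr rfl fun c _ => ?_
  rw [Finset.mul_sum]
  refine Finset.sum_congr rfl fun f _ => ?_
  simp only [Finset.prod_mul_distrib, Fintype.card_subtype, nsmul_eq_mul, Nat.cast_mul,
    Nat.cast_prod]
  ring

end Counting

end BlockEGF

namespace BlockEGF

open Finset PowerSeries

/-! ### Derivatives of products of power series -/

section Derivative

variable {R : Type*} [CommRing R]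

theorem derivative_prod {ι : Type*} [DecidableEq ι] (s : Finset ι) (g : ι → R⟦X⟧) :
    d⁄dX R (∏ i ∈ s, g i) = ∑ i ∈ s, (∏ j ∈ s.erase i, g j) * d⁄dX R (g i) := by
  induction s using Finset.induction_on with
  | empty => simp
  | insert a s ha ih =>
    rw [Finset.prod_insert ha, Derivation.leibniz, ih, Finset.sum_insert ha,
      Finset.erase_insert ha, smul_eq_mul, smul_eq_mul, add_comm, Finset.mul_sum]
    congr 1
    refine Finset.sum_congr rfl fun i hi => ?_
    have : i ≠ a := fun h => ha (h ▸ hi)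
    rw [Finset.erase_insert_of_ne this.symm, Finset.prod_insert (by simp [ha]), mul_assoc]

theorem derivative_prod_univ {ι : Type*} [Fintype ι] [DecidableEq ι] (g g' : ι → R⟦X⟧)
    (h : ∀ i, d⁄dX R (g i) = g' i) :
    d⁄dX R (∏ i, g i) = ∑ i, ∏ j, if j = i then g' j else g j := by
  rw [derivative_prod]
  refine Finset.sum_congr rfl fun i _ => ?_
  rw [← Finset.mul_prod_erase univ _ (Finset.mem_univ i), if_pos rfl, h, mul_comm]
  congr 1
  refine Finset.prod_congr rfl fun j hj => ?_
  rw [if_neg (Finset.ne_of_mem_erase hj)]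

/-- The factor `X ^ 2` outweighs the shift by the derivative, so only coefficients of index below
`n` enter. This allows an infinite sum over block sizes to be truncated. -/
theorem coeff_mul_derivative_congr {A F G : R⟦X⟧} {n : ℕ}
    (h : ∀ m < n, coeff m F = coeff m G) :
    coeff n (X * A * (X * d⁄dX R F)) = coeff n (X * A * (X * d⁄dX R G)) := by
  have h₁ : ∀ F : R⟦X⟧, X * A * (X * d⁄dX R F) = X ^ 2 * (A * d⁄dX R F) := fun F => by ring
  rw [h₁, h₁, coeff_X_pow_mul', coeff_X_pow_mul']
  split_ifs with hn
  · rw [coeff_mul, coeff_mul]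
    refine Finset.sum_congr rfl fun p hp => ?_
    have := Finset.HasAntidiagonal.mem_antidiagonal.mp hp
    rw [coeff_derivative, coeff_derivative, h _ (by omega)]
  · rfl

end Derivative

/-! ### Exponential generating functions -/

section ExponentialSeries

variable {R : Type*} [CommRing R] [Algebra ℚ R]

/-- The exponential generating function of a sequence. -/
noncomputable def egf (a : ℕ → R) : R⟦X⟧ := PowerSeries.mk fun n => (1 / (n.factorial : ℚ)) • a n

theorem coeff_egf (a : ℕ → R) (n : ℕ) :
    coeff n (egf a) = (1 / (n.factorial : ℚ)) • a n := coeff_mk _ _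

theorem derivative_egf (a : ℕ → R) : d⁄dX R (egf a) = egf fun n => a (n + 1) := by
  ext n
  rw [coeff_derivative, coeff_egf, coeff_egf, mul_comm, ← Nat.cast_succ, ← nsmul_eq_mul,
    ← Nat.cast_smul_eq_nsmul ℚ, smul_smul]
  congr 1
  have := Nat.factorial_ne_zero n
  rw [Nat.factorial_succ]
  push_cast
  field_simp

/-- The product formula for exponential generating functions. -/
theorem factorial_smul_coeff_prod_egf {ι : Type*} [Fintype ι] [DecidableEq ι] (a : ι → ℕ → R)
    (n : ℕ) : (n.factorial : ℚ) • coeff n (∏ i, egf (a i)) =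
      ∑ f : Fin n → ι, ∏ i, a i #{v | f v = i} := by
  induction n generalizing a with
  | zero =>
    rw [coeff_zero_eq_constantCoeff_apply, map_prod]
    simp [← coeff_zero_eq_constantCoeff_apply, coeff_egf]
  | succ n ih =>
    have h₁ : ((n + 1).factorial : ℚ) • coeff (n + 1) (∏ i, egf (a i)) =
        (n.factorial : ℚ) • coeff n (d⁄dX R (∏ i, egf (a i))) := by
      rw [coeff_derivative, Nat.factorial_succ, mul_comm (coeff _ _), ← Nat.cast_succ,
        ← nsmul_eq_mul, ← Nat.cast_smul_eq_nsmul ℚ, smul_smul]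
      push_cast
      ring_nf
    have h₂ : ∀ i, (∏ j, if j = i then egf (fun n => a j (n + 1)) else egf (a j)) =
        ∏ j, egf (fun n => if j = i then a j (n + 1) else a j n) := fun i =>
      Finset.prod_congr rfl fun j _ => by split_ifs <;> rfl
    rw [h₁, derivative_prod_univ _ _ fun i => derivative_egf (a i), map_sum, Finset.smul_sum]
    simp_rw [h₂, ih]
    -- The summand `i` of the Leibniz rule collects the maps that send the first element to `i`.
    rw [← (Fin.consEquiv fun _ : Fin (n + 1) => ι).sum_comp, Fintype.sum_prod_type]
    refine Finset.sum_congr rfl fun i _ => Finset.sum_congr rfl fun f _ => ?_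
    refine Finset.prod_congr rfl fun j _ => ?_
    simp only [Fin.consEquiv_apply]
    rw [Fin.card_filter_univ_succ']
    simp only [Fin.cons_zero, Fin.cons_succ]
    by_cases h : j = i
    · subst h
      simp [add_comm]
    · simp [h, Ne.symm h]

/-- Multiplication by `X` turns a discounted root into a labelled one, with `n` choices. The
truncated `n - 1` at `n = 0` is harmless because of the factor `n`. -/
theorem X_mul_egf (a : ℕ → R) : X * egf a = egf fun n => (n : R) * a (n - 1) := by
  ext n
  cases n with
  | zero => simp [coeff_egf]
  | succ n =>
    rw [coeff_succ_X_mul, coeff_egf, coeff_egf, ← nsmul_eq_mul, ← Nat.cast_smul_eq_nsmul ℚ,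
      smul_smul]
    simp only [Nat.add_sub_cancel]
    congr 1
    have := Nat.factorial_ne_zero n
    rw [Nat.factorial_succ]
    push_cast
    field_simp

theorem X_mul_derivative_egf (a : ℕ → R) :
    X * d⁄dX R (egf a) = egf fun n => (n : R) * a n := by
  rw [derivative_egf, X_mul_egf]
  ext n
  rw [coeff_egf, coeff_egf]
  cases n <;> simp

theorem C_mul_egf (r : R) (a : ℕ → R) : C r * egf a = egf fun n => r * a n := by
  ext n
  rw [coeff_C_mul, coeff_egf, coeff_egf, mul_smul_comm]

/-- Series with a given logarithmic derivative are determined by their constant coefficient. -/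
theorem eq_of_derivative_eq_mul {A B f : R⟦X⟧} (hA : d⁄dX R A = A * f) (hB : d⁄dX R B = B * f)
    (h : constantCoeff A = constantCoeff B) : A = B := by
  ext n
  induction n using Nat.strong_induction_on with
  | _ n ih =>
  cases n with
  | zero => simpa using h
  | succ n =>
    have h₁ : coeff n (d⁄dX R A) = coeff n (d⁄dX R B) := by
      rw [hA, hB, coeff_mul, coeff_mul]
      refine Finset.sum_congr rfl fun p hp => ?_
      rw [ih p.1 (by have := Finset.HasAntidiagonal.mem_antidiagonal.mp hp; omega)]
    rw [coeff_derivative, coeff_derivative] at h₁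
    have hu : IsUnit ((n : R) + 1) := by
      have : ((n : R) + 1) = algebraMap ℚ R ((n : ℚ) + 1) := by simp
      rw [this]
      exact (IsUnit.mk0 _ (by positivity)).map _
    exact hu.mul_right_cancel h₁

theorem derivative_exp_subst {F : R⟦X⟧} (hF : constantCoeff F = 0) :
    d⁄dX R ((exp R).subst F) = (exp R).subst F * d⁄dX R F := by
  rw [derivative_subst (HasSubst.of_constantCoeff_zero' hF), derivative_exp]

theorem constantCoeff_exp_subst {F : R⟦X⟧} (hF : constantCoeff F = 0) :
    constantCoeff ((exp R).subst F : R⟦X⟧) = 1 := by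
  have := PowerSeries.constantCoeff_subst (HasSubst.of_constantCoeff_zero' hF) (exp R)
  change MvPowerSeries.constantCoeff _ = _
  rw [this, finsum_eq_single _ 0]
  · simp
  · intro d hd
    rw [map_pow]
    change _ • (constantCoeff F) ^ d = _
    rw [hF, zero_pow hd, smul_zero]

end ExponentialSeries

/-! ### The differential equation for rooted graphs -/

section Functional

variable {R : Type*} [CommRing R] [Algebra ℚ R]

/-- The exponential generating function of the coloured graphs with root of type in `T`. -/
noncomputable def GraphClass.rootedSeries (𝒢 : GraphClass) (y : Fin 2 → R) (T : Set ℕ) : R⟦X⟧ :=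
  egf (𝒢.rootedCoeff y T)

open Classical in
/-- The series of the coloured graph that hangs at the vertex `v` of the coloured block `c`. -/
noncomputable def GraphClass.hangingSeries (𝒢 : GraphClass) (y : Fin 2 → R) {V : Type*}
    (c : SimpleGraph V × Set V) (v : V) : R⟦X⟧ :=
  X * (C (if v ∈ c.2 then y 0 else y 1) *
    𝒢.rootedSeries y (hangingTypes (vertexType c.1 c.2 v)))

/-- The contribution of the blocks with `k + 1` vertices to the series of one-block graphs. -/
noncomputable def GraphClass.blockTerm (𝒢 : GraphClass) (y : Fin 2 → R) (T : Set ℕ) (k : ℕ) :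
    R⟦X⟧ :=
  (1 / (k.factorial : ℚ)) • ∑ c ∈ (Set.toFinite (𝒢.rootedBlock (none : Option (Fin k)) T)).toFinset,
    ∏ j : Fin k, 𝒢.hangingSeries y c (some j)

/-- The series of the coloured graphs whose root lies in one block only. -/
noncomputable def GraphClass.blockSeries (𝒢 : GraphClass) (y : Fin 2 → R) (T : Set ℕ) : R⟦X⟧ :=
  PowerSeries.mk fun m => ∑ k ∈ range (m + 1), coeff m (𝒢.blockTerm y T k)

variable {𝒢 : GraphClass} {y : Fin 2 → R} {T : Set ℕ}

/-- Each of the `k` hanging series is divisible by `X`; hence each coefficient of the sum over all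
block sizes is a finite sum. -/
theorem GraphClass.coeff_blockTerm_of_lt {m k : ℕ} (h : m < k) :
    coeff m (𝒢.blockTerm y T k) = 0 := by
  unfold GraphClass.blockTerm
  rw [coeff_smul, map_sum, Finset.sum_eq_zero, smul_zero]
  intro c _
  simp only [GraphClass.hangingSeries, Finset.prod_mul_distrib, Finset.prod_const,
    Finset.card_univ, Fintype.card_fin]
  rw [coeff_X_pow_mul', if_neg (by omega)]

theorem GraphClass.coeff_blockSeries {m n : ℕ} (h : m < n) :
    coeff m (𝒢.blockSeries y T) = ∑ k ∈ range n, coeff m (𝒢.blockTerm y T k) := by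
  unfold GraphClass.blockSeries
  rw [coeff_mk]
  refine Finset.sum_subset (Finset.range_mono h) fun k _ hk => ?_
  exact GraphClass.coeff_blockTerm_of_lt (by simpa using hk)

theorem GraphClass.constantCoeff_blockSeries :
    constantCoeff (𝒢.blockSeries y T) = 0 := by
  rw [← coeff_zero_eq_constantCoeff_apply, GraphClass.coeff_blockSeries Nat.zero_lt_one,
    Finset.sum_range_one]
  unfold GraphClass.blockTerm
  have : (Set.toFinite (𝒢.rootedBlock (none : Option (Fin 0)) T)).toFinset = ∅ := by
    ext c
    simp only [Set.Finite.mem_toFinset, Finset.notMem_empty, iff_false]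
    intro hc
    exact not_subsingleton_iff_nontrivial.mpr hc.2.1.1 inferInstance
  rw [this, Finset.sum_empty, smul_zero, map_zero]

/-- Marking the vertices outside the root piece in a product of exponential generating functions. -/
theorem factorial_smul_coeff_mul_derivative_prod {k : ℕ} (a : Option (Fin k) → ℕ → R) (n : ℕ) :
    (n.factorial : ℚ) • coeff n (egf (a none) * (X * d⁄dX R (∏ j, egf (a (some j))))) =
      ∑ f : Fin n → Option (Fin k), (#{v | f v ≠ none} : R) * ∏ l, a l #{v | f v = l} := by
  -- By the Leibniz rule, `X` times the derivative marks one vertex in one of the pieces `some i`.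
  have h₁ : egf (a none) * (X * d⁄dX R (∏ j, egf (a (some j)))) =
      ∑ i : Fin k, ∏ l, egf (fun n => (if l = some i then (n : R) else 1) * a l n) := by
    rw [derivative_prod, Finset.mul_sum, Finset.mul_sum]
    refine Finset.sum_congr rfl fun i _ => ?_
    rw [Fintype.prod_option, ← Finset.mul_prod_erase univ _ (Finset.mem_univ i)]
    have h₂ : ∏ j ∈ univ.erase i, egf (fun n => (if (some j) = some i then (n : R) else 1) *
        a (some j) n) = ∏ j ∈ univ.erase i, egf (a (some j)) :=
      Finset.prod_congr rfl fun j hj => by simp [Finset.ne_of_mem_erase hj]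
    rw [h₂]
    simp only [reduceCtorEq, if_false, one_mul, if_true]
    rw [← X_mul_derivative_egf]
    ring
  rw [h₁, map_sum, Finset.smul_sum]
  simp_rw [factorial_smul_coeff_prod_egf]
  rw [Finset.sum_comm]
  refine Finset.sum_congr rfl fun f _ => ?_
  simp_rw [Finset.prod_mul_distrib]
  rw [← Finset.sum_mul]
  congr 1
  simp only [Finset.prod_ite_eq', Finset.mem_univ, if_true]
  rw [← Nat.cast_sum]
  congr 1
  have := Finset.card_eq_sum_card_fiberwise (f := f) (s := univ) (t := univ) (by simp)
  rw [Fintype.sum_option,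
    ← Finset.card_filter_add_card_filter_not (s := univ) (fun v => f v = none)] at this
  simp only [Ne] at *
  omega

theorem GraphClass.hangingSeries_eq {k : ℕ}
    (c : SimpleGraph (Option (Fin k)) × Set (Option (Fin k)))
    (v : Option (Fin k)) [Decidable (v ∈ c.2)] : 𝒢.hangingSeries y c v =
      egf fun n => (if v ∈ c.2 then y 0 else y 1) *
        ((n : R) * 𝒢.rootedCoeff y (hangingTypes (vertexType c.1 c.2 v)) (n - 1)) := by
  unfold GraphClass.hangingSeries GraphClass.rootedSeries
  rw [mul_left_comm, X_mul_egf, C_mul_egf]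
  congr!

/-- This is `card_mul_rootedCoeff` read as an identity of series, with `X ^ 2` cancelled: one `X`
labels the root, and `X` times the derivative marks the second vertex. On the right, the first
factor is the piece at the root and the second marks a vertex in the pieces at the other vertices of
the block. -/
theorem GraphClass.BlockStable.derivative_rootedSeries (h𝒢 : 𝒢.BlockStable) (y : Fin 2 → R)
    (hT : IsGlueable T) :
    d⁄dX R (𝒢.rootedSeries y T) = 𝒢.rootedSeries y T * d⁄dX R (𝒢.blockSeries y T) := by
  classical
  have key : X * (X * d⁄dX R (𝒢.rootedSeries y T)) =
      X * 𝒢.rootedSeries y T * (X * d⁄dX R (𝒢.blockSeries y T)) := by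
    ext n
    have hfac : IsUnit (n.factorial : ℚ) := by
      have := Nat.factorial_ne_zero n
      exact IsUnit.mk0 _ (by exact_mod_cast this)
    refine hfac.smul_left_cancel.mp ?_
    have hl : (n.factorial : ℚ) • coeff n (X * (X * d⁄dX R (𝒢.rootedSeries y T))) =
        ((n * (n - 1) : ℕ) : R) * 𝒢.rootedCoeff y T (n - 1) := by
      unfold GraphClass.rootedSeries
      have := Nat.factorial_ne_zero n
      rw [X_mul_derivative_egf, X_mul_egf, coeff_egf, smul_smul, mul_one_div_cancel
        (by exact_mod_cast this), one_smul]
      push_cast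
      ring
    rw [hl, h𝒢.card_mul_rootedCoeff y hT n, coeff_mul_derivative_congr
      (G := ∑ k ∈ range n, 𝒢.blockTerm y T k) fun m hm => by
        rw [GraphClass.coeff_blockSeries hm, map_sum], map_sum, Finset.mul_sum, Finset.mul_sum,
      map_sum, Finset.smul_sum]
    refine Finset.sum_congr rfl fun k _ => ?_
    unfold GraphClass.blockTerm
    rw [Derivation.map_smul_of_tower, mul_smul_comm, mul_smul_comm, coeff_smul, smul_comm]
    congr 1
    rw [map_sum, Finset.mul_sum, Finset.mul_sum, map_sum, Finset.smul_sum]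
    refine Finset.sum_congr rfl fun c _ => ?_
    have hroot : X * 𝒢.rootedSeries y T = egf fun n => (n : R) * 𝒢.rootedCoeff y T (n - 1) :=
      X_mul_egf _
    -- The weight of a piece with `n` vertices, its own root labelled and coloured; only the colour
    -- of the overall root `none` is discounted.
    let a : Option (Fin k) → ℕ → R := fun l n =>
      (if l = none then 1 else if l ∈ c.2 then y 0 else y 1) *
        ((n : R) * 𝒢.rootedCoeff y (pieceTypes T none c l) (n - 1))
    have h₁ : egf (a none) = X * 𝒢.rootedSeries y T := by
      rw [hroot]
      simp [a, pieceTypes]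
    have h₂ : ∀ j, egf (a (some j)) = 𝒢.hangingSeries y c (some j) := fun j => by
      rw [GraphClass.hangingSeries_eq]
      simp [a, pieceTypes]
    have := factorial_smul_coeff_mul_derivative_prod a n
    simp_rw [h₁, h₂] at this
    rw [this, Finset.mul_sum]
    refine Finset.sum_congr rfl fun f _ => ?_
    simp only [a, weight, Finset.prod_mul_distrib]
    rw [mul_left_comm]
    congr!
  have h : X ^ 2 * d⁄dX R (𝒢.rootedSeries y T) =
      X ^ 2 * (𝒢.rootedSeries y T * d⁄dX R (𝒢.blockSeries y T)) := by
    linear_combination key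
  exact X_pow_mul_cancel h

end Functional

end BlockEGF

namespace BlockEGF

open Finset PowerSeries

/-! ### Solving the differential equation -/

section Solution

variable {R : Type*} [CommRing R] [Algebra ℚ R] {𝒢 : GraphClass}

/-- A single vertex has no blocks, so its graph is in the class. The vertex has type 0 or 2
according to its colour, and every glueable set contains exactly one of these. -/
theorem GraphClass.BlockStable.rooted_fin_one (h𝒢 : 𝒢.BlockStable) {T : Set ℕ}
    (hT : IsGlueable T) :
    𝒢.rooted (Fin.last 0) T = {((⊥ : SimpleGraph (Fin 1)), {_v | 0 ∈ T})} := by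
  have hconn : (⊥ : SimpleGraph (Fin 1)).Connected := by
    rw [connected_iff_conn_univ]
    have : (Set.univ : Set (Fin 1)) = {0} := Set.eq_singleton_iff_unique_mem.mpr
      ⟨trivial, fun _ _ => Subsingleton.elim _ _⟩
    rw [this]
    exact conn_singleton _ _
  have hmem : 𝒢.Mem (⊥ : SimpleGraph (Fin 1)) := by
    rw [h𝒢.mem_fin_iff_maximal _ hconn]
    intro X hX
    obtain ⟨a, -, b, -, hab⟩ := hX.1.1
    exact absurd (Subsingleton.elim a b) hab
  have htype : ∀ J : Set (Fin 1), vertexType ⊥ J (Fin.last 0) ∈ T ↔ J = {_v | 0 ∈ T} := by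
    intro J
    have hJ : J = {_v | 0 ∈ T} ↔ (Fin.last 0 ∈ J ↔ 0 ∈ T) := by
      rw [Set.ext_iff]
      exact ⟨fun h => h _, fun h v => by rw [Subsingleton.elim v (Fin.last 0)]; exact h⟩
    rw [hJ]
    rcases hT with rfl | rfl | rfl <;>
      simp [vertexType_eq_zero_iff, vertexType_eq_one_iff, vertexType_eq_two_iff]
  have : Subsingleton (Fin (0 + 1)) := inferInstanceAs (Subsingleton (Fin 1))
  have : Subsingleton (SimpleGraph (Fin (0 + 1))) :=
    inferInstanceAs (Subsingleton (SimpleGraph (Fin 1)))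
  ext ⟨G, J⟩
  obtain rfl : G = ⊥ := Subsingleton.elim _ _
  simp only [Set.mem_singleton_iff, Prod.mk.injEq, true_and, ← htype]
  refine ⟨fun h => h.2.2.2.1, fun h => ⟨hmem, hconn, fun a _ b _ hab => ?_, h, fun v hv => ?_⟩⟩
  · exact absurd (Subsingleton.elim a b) hab
  · exact absurd (Subsingleton.elim v _) hv

theorem GraphClass.BlockStable.constantCoeff_rootedSeries (h𝒢 : 𝒢.BlockStable) (y : Fin 2 → R)
    {T : Set ℕ} (hT : IsGlueable T) : constantCoeff (𝒢.rootedSeries y T) = 1 := by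
  have h : (Set.toFinite (𝒢.rooted (Fin.last 0) T)).toFinset =
      {((⊥ : SimpleGraph (Fin 1)), {_v | 0 ∈ T})} := by
    ext q
    rw [Set.Finite.mem_toFinset, h𝒢.rooted_fin_one hT]
    simp
  unfold GraphClass.rootedSeries
  rw [← coeff_zero_eq_constantCoeff_apply, coeff_egf]
  unfold GraphClass.rootedCoeff GraphClass.rootedSum
  rw [h, Finset.sum_singleton]
  unfold weight
  simp

theorem GraphClass.rootedSeries_union (y : Fin 2 → R) {T T' : Set ℕ} (h : Disjoint T T') :
    𝒢.rootedSeries y (T ∪ T') = 𝒢.rootedSeries y T + 𝒢.rootedSeries y T' := by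
  classical
  ext n
  unfold GraphClass.rootedSeries
  rw [map_add, coeff_egf, coeff_egf, coeff_egf, ← smul_add]
  congr 1
  unfold GraphClass.rootedCoeff GraphClass.rootedSum
  rw [← Finset.sum_union]
  · congr 1
    ext q
    simp only [Set.Finite.mem_toFinset, Finset.mem_union, GraphClass.rooted, Set.mem_ofPred_eq,
      IsDominatedExcept, Set.mem_union]
    tauto
  · rw [Finset.disjoint_left]
    intro q hq hq'
    rw [Set.Finite.mem_toFinset] at hq hq'
    exact Set.disjoint_left.mp h hq.2.2.2.1 hq'.2.2.2.1

theorem GraphClass.blockSeries_union (y : Fin 2 → R) {T T' : Set ℕ} (h : Disjoint T T') :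
    𝒢.blockSeries y (T ∪ T') = 𝒢.blockSeries y T + 𝒢.blockSeries y T' := by
  classical
  ext n
  unfold GraphClass.blockSeries
  rw [map_add, coeff_mk, coeff_mk, coeff_mk, ← Finset.sum_add_distrib]
  refine Finset.sum_congr rfl fun k _ => ?_
  rw [← map_add]
  unfold GraphClass.blockTerm
  rw [← smul_add, ← Finset.sum_union]
  · congr 3
    ext q
    simp only [Set.Finite.mem_toFinset, Finset.mem_union, GraphClass.rootedBlock,
      Set.mem_ofPred_eq, Set.mem_union]
    tauto
  · rw [Finset.disjoint_left]
    intro q hq hq'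
    rw [Set.Finite.mem_toFinset] at hq hq'
    exact Set.disjoint_left.mp h hq.2.2.2 hq'.2.2.2

/-- Both sides solve `F' = F * E'`, with `E` the block series, and have constant coefficient 1. -/
theorem GraphClass.BlockStable.rootedSeries_eq_exp (h𝒢 : 𝒢.BlockStable) (y : Fin 2 → R)
    {T : Set ℕ} (hT : IsGlueable T) :
    𝒢.rootedSeries y T = (exp R).subst (𝒢.blockSeries y T) :=
  eq_of_derivative_eq_mul (h𝒢.derivative_rootedSeries y hT)
    (derivative_exp_subst GraphClass.constantCoeff_blockSeries)
    (by rw [h𝒢.constantCoeff_rootedSeries y hT,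
      constantCoeff_exp_subst GraphClass.constantCoeff_blockSeries])

theorem exp_subst_add {F G : R⟦X⟧} (hF : constantCoeff F = 0) (hG : constantCoeff G = 0) :
    ((exp R).subst (F + G) : R⟦X⟧) = (exp R).subst F * (exp R).subst G := by
  have hFG : constantCoeff (F + G) = 0 := by rw [map_add, hF, hG, add_zero]
  refine eq_of_derivative_eq_mul (f := d⁄dX R (F + G)) (derivative_exp_subst hFG) ?_ ?_
  · rw [Derivation.leibniz, derivative_exp_subst hF, derivative_exp_subst hG, map_add,
      smul_eq_mul, smul_eq_mul]
    ring
  · rw [map_mul, constantCoeff_exp_subst hF, constantCoeff_exp_subst hG,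
      constantCoeff_exp_subst hFG, one_mul]

/-- The set `{1}` is not glueable, but `{1, 2}` and `{2}` are; the exponential for `{1, 2}` factors,
and the series for `{2}` is subtracted. -/
theorem GraphClass.BlockStable.rootedSeries_one (h𝒢 : 𝒢.BlockStable) (y : Fin 2 → R) :
    𝒢.rootedSeries y {1} =
      ((exp R).subst (𝒢.blockSeries y {1}) - 1) * 𝒢.rootedSeries y {2} := by
  have h12 : Disjoint ({1} : Set ℕ) {2} := by simp
  have h : 𝒢.rootedSeries y ({1} ∪ {2}) = _ := h𝒢.rootedSeries_eq_exp y (Or.inr (Or.inl rfl))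
  rw [GraphClass.rootedSeries_union y h12, GraphClass.blockSeries_union y h12,
    exp_subst_add GraphClass.constantCoeff_blockSeries GraphClass.constantCoeff_blockSeries,
    ← h𝒢.rootedSeries_eq_exp y (Or.inr (Or.inr rfl))] at h
  linear_combination h

end Solution

end BlockEGF

namespace BlockEGF

open Finset

/-! ### Transfer to multivariate series, with `x` singled out -/

section Transfer

/-- The ring of coefficients of the series in `x`: power series in `y₀` and `y₁`. -/
abbrev CoeffRing : Type := MvPowerSeries (Fin 2) ℚ

/-- The variables `y₀` and `y₁`. -/
noncomputable def yVar : Fin 2 → CoeffRing := MvPowerSeries.X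

open Classical in
theorem weight_yVar {V : Type*} [Fintype V] (J : Set V) (r : V) :
    weight yVar J r = MvPowerSeries.monomial
      (∑ v with v ≠ r, Finsupp.single (if v ∈ J then (0 : Fin 2) else 1) 1) 1 := by
  unfold weight
  have h : ∀ s : Finset V, MvPowerSeries.monomial (R := ℚ)
      (∑ v ∈ s, Finsupp.single (if v ∈ J then (0 : Fin 2) else 1) 1) 1 =
      ∏ v ∈ s, yVar (if v ∈ J then (0 : Fin 2) else 1) := by
    intro s
    induction s using Finset.induction_on with
    | empty => simp
    | insert a s ha ih =>
      rw [Finset.sum_insert ha, Finset.prod_insert ha, ← ih]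
      unfold yVar MvPowerSeries.X
      rw [MvPowerSeries.monomial_mul_monomial, one_mul]
  rw [h, Finset.prod_filter]
  refine Finset.prod_congr rfl fun v _ => ?_
  by_cases hv : v = r
  · simp [hv]
  · by_cases hJ : v ∈ J <;> simp [hv, hJ]

-- Without type 2 away from the root, the type of such a vertex is read off from membership in `J`,
-- so the weight records both type counts.
open Classical in
theorem coeff_weight_yVar {V : Type*} [Fintype V] {G : SimpleGraph V} {J : Set V} {r : V}
    (h : ∀ v, v ≠ r → vertexType G J v ≠ 2) (x : Fin 2 →₀ ℕ) :
    MvPowerSeries.coeff x (weight yVar J r) =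
      if ∀ j : Fin 2, {v | v ≠ r ∧ vertexType G J v = j}.ncard = x j then 1 else 0 := by
  rw [weight_yVar, MvPowerSeries.coeff_monomial]
  refine if_congr ?_ rfl rfl
  rw [DFunLike.ext_iff]
  refine forall_congr' fun j => ?_
  rw [eq_comm, Finsupp.finsetSum_apply]
  have h₁ : {v | v ≠ r ∧ vertexType G J v = j}.ncard =
      ∑ v with v ≠ r, (Finsupp.single (if v ∈ J then (0 : Fin 2) else 1) 1) j := by
    have h₂ : {v | v ≠ r ∧ vertexType G J v = j} =
        (({v | v ≠ r} : Finset V).filter fun v => vertexType G J v = j : Finset V) := by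
      ext v
      simp
    rw [h₂, Set.ncard_coe_finset, Finset.card_filter]
    refine Finset.sum_congr rfl fun v hv => ?_
    have hv' := h v (Finset.mem_filter.mp hv).2
    have hle := vertexType_le_two G J v
    have h0 := vertexType_eq_zero_iff (G := G) (J := J) (v := v)
    rw [Finsupp.single_apply]
    fin_cases j
    · by_cases hJ : v ∈ J <;> simp [hJ, h0]
    · by_cases hJ : v ∈ J
      · simp [hJ, h0.mpr hJ]
      · have : vertexType G J v = 1 := by
          have : vertexType G J v ≠ 0 := fun h => hJ (h0.mp h)
          omega
        simp [hJ, this]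
  rw [h₁]

theorem finSuccEquiv_pointedEGF {𝒢 : GraphClass} {T : Set ℕ}
    (P : ∀ n : ℕ, SimpleGraph (Fin (n + 1)) → Set (Fin (n + 1)) → Prop)
    (hP : ∀ n G J, P n G J ↔ (G, J) ∈ 𝒢.rooted (Fin.last n) T) :
    MvPowerSeries.finSuccEquiv ℚ 2 (pointedEGF 2 P) = 𝒢.rootedSeries yVar T := by
  classical
  ext n x
  rw [MvPowerSeries.coeff_coeff_finSuccEquiv]
  unfold GraphClass.rootedSeries
  rw [coeff_egf, MvPowerSeries.coeff_smul]
  unfold GraphClass.rootedCoeff GraphClass.rootedSum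
  rw [map_sum, Finset.sum_congr rfl fun q hq =>
    coeff_weight_yVar ((Set.Finite.mem_toFinset _).mp hq).2.2.2.2 x, ← Finset.sum_filter,
    Finset.sum_const, nsmul_eq_mul, mul_one, mul_comm, mul_one_div]
  change (Nat.card {q : SimpleGraph (Fin (n + 1)) × Set (Fin (n + 1)) // P n q.1 q.2 ∧
    ∀ j : Fin 2, {v | v ≠ Fin.last n ∧ vertexType q.1 q.2 v = j}.ncard = x j} : ℚ) / _ = _
  congr 2
  refine Nat.subtype_card _ fun q => ?_
  rw [Finset.mem_filter, Set.Finite.mem_toFinset]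
  exact and_congr (hP n q.1 q.2).symm Iff.rfl

/-- Coefficientwise, both sides are finite sums over the powers of `f`, and `finSuccEquiv` respects
powers. -/
theorem finSuccEquiv_expSeries {f : MvPowerSeries (Fin 3) ℚ}
    (hf : MvPowerSeries.constantCoeff f = 0)
    (hf' : PowerSeries.constantCoeff (MvPowerSeries.finSuccEquiv ℚ 2 f) = 0) :
    MvPowerSeries.finSuccEquiv ℚ 2 (expSeries f) =
      (PowerSeries.exp CoeffRing).subst (MvPowerSeries.finSuccEquiv ℚ 2 f) := by
  ext n x
  have hs := PowerSeries.HasSubst.of_constantCoeff_zero' hf'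
  have hfin := PowerSeries.coeff_subst_finite' hs (PowerSeries.exp CoeffRing) n
  unfold expSeries
  rw [MvPowerSeries.coeff_coeff_finSuccEquiv,
    PowerSeries.coeff_subst (PowerSeries.HasSubst.of_constantCoeff_zero hf),
    PowerSeries.coeff_subst' hs]
  have := (MvPowerSeries.coeff (R := ℚ) x).toAddMonoidHom.map_finsum hfin
  refine Eq.trans ?_ this.symm
  refine finsum_congr fun d => ?_
  change _ = MvPowerSeries.coeff x (PowerSeries.coeff d (PowerSeries.exp CoeffRing) •
    PowerSeries.coeff n (MvPowerSeries.finSuccEquiv ℚ 2 f ^ d))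
  rw [PowerSeries.coeff_exp, PowerSeries.coeff_exp, algebraMap_smul, algebraMap_smul CoeffRing,
    ← map_pow, MvPowerSeries.coeff_smul, MvPowerSeries.coeff_coeff_finSuccEquiv]
  rfl

variable {𝒢 : GraphClass}

theorem finSuccEquiv_C₀ : MvPowerSeries.finSuccEquiv ℚ 2 𝒢.C₀ = 𝒢.rootedSeries yVar {0} := by
  refine finSuccEquiv_pointedEGF _ fun n G J => ?_
  simp only [GraphClass.rooted, Set.mem_ofPred_eq, GraphClass.mem_fin_iff, IsDominatedExcept,
    IsMaximalIndepSet, Set.mem_singleton_iff, Ne, vertexType_eq_two_iff]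
  have := vertexType_eq_zero_iff (G := G) (J := J) (v := Fin.last n)
  grind

theorem finSuccEquiv_C₁ : MvPowerSeries.finSuccEquiv ℚ 2 𝒢.C₁ = 𝒢.rootedSeries yVar {1} := by
  refine finSuccEquiv_pointedEGF _ fun n G J => ?_
  simp only [GraphClass.rooted, Set.mem_ofPred_eq, GraphClass.mem_fin_iff, IsDominatedExcept,
    IsMaximalIndepSet, Set.mem_singleton_iff, Ne, vertexType_eq_two_iff]
  have := vertexType_eq_one_iff (G := G) (J := J) (v := Fin.last n)
  grind

theorem finSuccEquiv_C₂ : MvPowerSeries.finSuccEquiv ℚ 2 𝒢.C₂ = 𝒢.rootedSeries yVar {2} := by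
  refine finSuccEquiv_pointedEGF _ fun n G J => ?_
  simp only [GraphClass.rooted, Set.mem_ofPred_eq, GraphClass.mem_fin_iff, IsDominatedExcept,
    IsSpecialIndepSet, Set.mem_singleton_iff]
  have := vertexType_le_two G J
  grind

/-- The image of the arguments of the substitution, apart from `x`. -/
noncomputable def GraphClass.argSeries (𝒢 : GraphClass) (t : ℕ) : PowerSeries CoeffRing :=
  PowerSeries.C (if t = 0 then yVar 0 else yVar 1) * 𝒢.rootedSeries yVar (hangingTypes t)

theorem finSuccEquiv_args_zero : MvPowerSeries.finSuccEquiv ℚ 2 (𝒢.args 0) = PowerSeries.X :=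
  MvPowerSeries.finSuccEquiv_X_zero

theorem finSuccEquiv_args_succ (t : Fin 3) :
    MvPowerSeries.finSuccEquiv ℚ 2 (𝒢.args t.succ) = 𝒢.argSeries t := by
  have h₁ : MvPowerSeries.finSuccEquiv ℚ 2 (MvPowerSeries.X 1) = PowerSeries.C (yVar 0) :=
    MvPowerSeries.finSuccEquiv_X_succ 0
  have h₂ : MvPowerSeries.finSuccEquiv ℚ 2 (MvPowerSeries.X 2) = PowerSeries.C (yVar 1) :=
    MvPowerSeries.finSuccEquiv_X_succ 1
  have h12 : Disjoint ({1} : Set ℕ) {2} := by simp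
  fin_cases t
  · change MvPowerSeries.finSuccEquiv ℚ 2 (MvPowerSeries.X 1 * 𝒢.C₀) = _
    rw [map_mul, h₁, finSuccEquiv_C₀]
    simp [GraphClass.argSeries, hangingTypes]
  · change MvPowerSeries.finSuccEquiv ℚ 2 (MvPowerSeries.X 2 * (𝒢.C₁ + 𝒢.C₂)) = _
    rw [map_mul, map_add, h₂, finSuccEquiv_C₁, finSuccEquiv_C₂,
      ← GraphClass.rootedSeries_union _ h12, Set.singleton_union]
    simp [GraphClass.argSeries, hangingTypes]
  · change MvPowerSeries.finSuccEquiv ℚ 2 (MvPowerSeries.X 2 * 𝒢.C₁) = _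
    rw [map_mul, h₂, finSuccEquiv_C₁]
    simp [GraphClass.argSeries, hangingTypes]

theorem GraphClass.hangingSeries_eq_argSeries {V : Type*} (c : SimpleGraph V × Set V) (v : V) :
    𝒢.hangingSeries yVar c v = PowerSeries.X * 𝒢.argSeries (vertexType c.1 c.2 v) := by
  classical
  unfold GraphClass.hangingSeries GraphClass.argSeries
  congr 3
  exact if_congr vertexType_eq_zero_iff.symm rfl rfl

/-- The exponent of the monomial of a coloured pointed graph. -/
noncomputable def typeVector {n : ℕ} (c : SimpleGraph (Fin (n + 1)) × Set (Fin (n + 1))) :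
    Fin 4 →₀ ℕ :=
  Finsupp.cons n (Finsupp.equivFunOnFinite.symm fun j : Fin 3 =>
    {v | v ≠ Fin.last n ∧ vertexType c.1 c.2 v = j}.ncard)

/-- The monomial in the arguments of the substitution. -/
noncomputable def GraphClass.argMonomial (𝒢 : GraphClass) (d : Fin 4 →₀ ℕ) :
    MvPowerSeries (Fin 3) ℚ := d.prod fun s e => 𝒢.args s ^ e

theorem finSuccEquiv_argMonomial (d : Fin 4 →₀ ℕ) :
    MvPowerSeries.finSuccEquiv ℚ 2 (𝒢.argMonomial d) =
      PowerSeries.X ^ d 0 * ∏ t : Fin 3, 𝒢.argSeries t ^ d t.succ := by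
  unfold GraphClass.argMonomial
  rw [Finsupp.prod_fintype _ _ (by simp), Fin.prod_univ_succ, map_mul, map_pow,
    finSuccEquiv_args_zero, map_prod]
  simp_rw [map_pow, finSuccEquiv_args_succ]

theorem finSuccEquiv_argMonomial_typeVector {n : ℕ}
    (c : SimpleGraph (Fin (n + 1)) × Set (Fin (n + 1))) :
    MvPowerSeries.finSuccEquiv ℚ 2 (𝒢.argMonomial (typeVector c)) =
      ∏ v with v ≠ Fin.last n, 𝒢.hangingSeries yVar c v := by
  classical
  rw [finSuccEquiv_argMonomial]
  simp_rw [GraphClass.hangingSeries_eq_argSeries]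
  rw [Finset.prod_mul_distrib, Finset.prod_const, Finset.filter_ne',
    Finset.card_erase_of_mem (Finset.mem_univ _), Finset.card_univ, Fintype.card_fin,
    ← Finset.filter_ne']
  congr 1
  rw [← Finset.prod_fiberwise _ fun v => (⟨vertexType c.1 c.2 v,
    Nat.lt_succ_of_le (vertexType_le_two _ _ _)⟩ : Fin 3)]
  refine Finset.prod_congr rfl fun t _ => ?_
  have h₁ : typeVector c t.succ = #{v ∈ ({v | v ≠ Fin.last n} : Finset (Fin (n + 1))) |
      (⟨vertexType c.1 c.2 v, Nat.lt_succ_of_le (vertexType_le_two _ _ _)⟩ : Fin 3) = t} := by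
    rw [← Set.ncard_coe_finset]
    change Set.ncard _ = _
    congr 1
    ext v
    simp [Fin.ext_iff]
  rw [h₁, ← Finset.prod_const]
  refine Finset.prod_congr rfl fun v hv => ?_
  rw [← (Finset.mem_filter.mp hv).2]

theorem GraphClass.blockTerm_eq {R : Type*} [CommRing R] [Algebra ℚ R] (y : Fin 2 → R) (T : Set ℕ)
    (k : ℕ) : 𝒢.blockTerm y T k = (1 / (k.factorial : ℚ)) •
      ∑ c ∈ (Set.toFinite (𝒢.rootedBlock (Fin.last k) T)).toFinset,
        ∏ v with v ≠ Fin.last k, 𝒢.hangingSeries y c v := by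
  unfold GraphClass.blockTerm
  congr 1
  symm
  let e : Option (Fin k) ≃ Fin (k + 1) := finSuccEquivLast.symm
  have he : e none = Fin.last k := finSuccEquivLast_symm_none
  refine Finset.sum_equiv (colouredEquiv e) (fun c => ?_) fun c _ => ?_
  · rw [Set.Finite.mem_toFinset, Set.Finite.mem_toFinset, ← he]
    exact (𝒢.rootedBlock_comap e none T c.1 c.2).symm
  · have h : ∀ v, 𝒢.hangingSeries y (colouredEquiv e c) v = 𝒢.hangingSeries y c (e v) := by
      intro v
      unfold GraphClass.hangingSeries
      change PowerSeries.X * (_ * 𝒢.rootedSeries y (hangingTypes (vertexType (c.1.comap e)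
        (e ⁻¹' c.2) v))) = _
      rw [vertexType_comap]
      rfl
    simp_rw [h]
    rw [Finset.prod_filter, ← e.prod_comp, Fintype.prod_option]
    have hne : ∀ j, e (some j) ≠ Fin.last k := fun j h => by
      rw [← he] at h
      exact Option.some_ne_none j (e.injective h)
    simp [he, hne]

theorem coeff_B (i : Fin 3) (d : Fin 4 →₀ ℕ) :
    MvPowerSeries.coeff d (𝒢.B i) = (1 / ((d 0).factorial : ℚ)) *
      #{c ∈ (Set.toFinite (𝒢.rootedBlock (Fin.last (d 0)) {(i : ℕ)})).toFinset |
        typeVector c = d} := by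
  classical
  change (Nat.card _ : ℚ) / _ = _
  rw [mul_comm, mul_one_div]
  congr 2
  refine Nat.subtype_card _ fun q => ?_
  rw [Finset.mem_filter, Set.Finite.mem_toFinset]
  refine and_congr ?_ ?_
  · simp only [GraphClass.rootedBlock, Set.mem_ofPred_eq, GraphClass.mem_fin_iff,
      Set.mem_singleton_iff]
  · rw [DFunLike.ext_iff, Fin.forall_fin_succ]
    exact ⟨fun h => h.2, fun h => ⟨rfl, h⟩⟩

theorem coeff_argMonomial_of_lt {d : Fin 4 →₀ ℕ} {n : ℕ} (h : n < d 0) (x : Fin 2 →₀ ℕ) :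
    MvPowerSeries.coeff (Finsupp.cons n x) (𝒢.argMonomial d) = 0 := by
  rw [← MvPowerSeries.coeff_coeff_finSuccEquiv, finSuccEquiv_argMonomial,
    PowerSeries.coeff_X_pow_mul', if_neg (by omega), map_zero]

/-- The coefficients of `Bᵢ` count coloured blocks by type vector, so the substitution sums one
monomial in the arguments per block, and that monomial is the product of its hanging series. Blocks
with more than `n` non-root vertices do not reach `x ^ n`, which leaves the finite family `D`. -/
theorem finSuccEquiv_Bsubst (i : Fin 3) :
    MvPowerSeries.finSuccEquiv ℚ 2 (𝒢.Bsubst i) = 𝒢.blockSeries yVar {(i : ℕ)} := by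
  classical
  ext n x
  let S : ∀ k : ℕ, Finset (SimpleGraph (Fin (k + 1)) × Set (Fin (k + 1))) := fun k =>
    (Set.toFinite (𝒢.rootedBlock (Fin.last k) {(i : ℕ)})).toFinset
  let g : (Σ k : ℕ, SimpleGraph (Fin (k + 1)) × Set (Fin (k + 1))) → ℚ := fun s =>
    (1 / (s.1.factorial : ℚ)) *
      MvPowerSeries.coeff (Finsupp.cons n x) (𝒢.argMonomial (typeVector s.2))
  let D : Finset (Σ k : ℕ, SimpleGraph (Fin (k + 1)) × Set (Fin (k + 1))) := (range (n + 1)).sigma S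
  have hr : MvPowerSeries.coeff x (PowerSeries.coeff n (𝒢.blockSeries yVar {(i : ℕ)})) =
      ∑ s ∈ D, g s := by
    rw [Finset.sum_sigma, GraphClass.coeff_blockSeries (Nat.lt_succ_self n), map_sum]
    refine Finset.sum_congr rfl fun k _ => ?_
    rw [GraphClass.blockTerm_eq, PowerSeries.coeff_smul, MvPowerSeries.coeff_smul, map_sum, map_sum,
      Finset.mul_sum]
    refine Finset.sum_congr rfl fun c _ => ?_
    rw [← finSuccEquiv_argMonomial_typeVector, MvPowerSeries.coeff_coeff_finSuccEquiv]
  have hterm : ∀ d : Fin 4 →₀ ℕ, MvPowerSeries.coeff d (𝒢.B i) •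
      MvPowerSeries.coeff (Finsupp.cons n x) (𝒢.argMonomial d) =
      ∑ s ∈ D with typeVector s.2 = d, g s := by
    intro d
    rw [coeff_B, smul_eq_mul]
    by_cases hd : d 0 < n + 1
    · have h₁ : ({s ∈ D | typeVector s.2 = d}) =
          ({c ∈ S (d 0) | typeVector c = d}).map (Function.Embedding.sigmaMk (d 0)) := by
        ext ⟨k, c⟩
        simp only [Finset.mem_filter, Finset.mem_map, Function.Embedding.sigmaMk_apply, D,
          Finset.mem_sigma, Finset.mem_range]
        constructor
        · rintro ⟨⟨hk, hc⟩, rfl⟩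
          exact ⟨c, ⟨hc, rfl⟩, rfl⟩
        · rintro ⟨c', ⟨hc', hcd⟩, heq⟩
          rw [Sigma.mk.injEq] at heq
          obtain ⟨rfl, heq⟩ := heq
          obtain rfl := eq_of_heq heq
          exact ⟨⟨hd, hc'⟩, hcd⟩
      rw [h₁, Finset.sum_map]
      have h₂ : ∀ c ∈ ({c ∈ S (d 0) | typeVector c = d}),
          g (Function.Embedding.sigmaMk (d 0) c) = (1 / ((d 0).factorial : ℚ)) *
            MvPowerSeries.coeff (Finsupp.cons n x) (𝒢.argMonomial d) := by
        intro c hc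
        have := (Finset.mem_filter.mp hc).2
        simp only [g, Function.Embedding.sigmaMk_apply, this]
      rw [Finset.sum_congr rfl h₂, Finset.sum_const, nsmul_eq_mul]
      ring
    · rw [coeff_argMonomial_of_lt (by omega), mul_zero, Finset.sum_eq_zero]
      rintro ⟨k, c⟩ hs
      obtain ⟨hs₁, rfl⟩ := Finset.mem_filter.mp hs
      exact absurd (Finset.mem_range.mp (Finset.mem_sigma.mp hs₁).1) hd
  rw [hr, MvPowerSeries.coeff_coeff_finSuccEquiv]
  unfold GraphClass.Bsubst
  rw [MvPowerSeries.coeff_subst 𝒢.hasSubst_args]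
  refine (finsum_congr hterm).trans ?_
  rw [finsum_eq_sum_of_support_subset (s := D.image fun s => typeVector s.2)]
  · exact Finset.sum_fiberwise_of_maps_to (fun s hs => Finset.mem_image_of_mem _ hs) g
  · intro d hd
    obtain ⟨s, hs, -⟩ := Finset.exists_ne_zero_of_sum_ne_zero hd
    obtain ⟨hs₁, hs₂⟩ := Finset.mem_filter.mp hs
    exact Finset.mem_coe.mpr (Finset.mem_image.mpr ⟨s, hs₁, hs₂⟩)

theorem finSuccEquiv_expSeries_Bsubst (i : Fin 3) :
    MvPowerSeries.finSuccEquiv ℚ 2 (expSeries (𝒢.Bsubst i)) =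
      (PowerSeries.exp CoeffRing).subst (𝒢.blockSeries yVar {(i : ℕ)}) := by
  rw [← finSuccEquiv_Bsubst]
  refine finSuccEquiv_expSeries (𝒢.constantCoeff_Bsubst i) ?_
  rw [finSuccEquiv_Bsubst]
  exact GraphClass.constantCoeff_blockSeries

end Transfer

end BlockEGF

theorem mainTheorem5 (𝒢 : BlockEGF.GraphClass) (h𝒢 : 𝒢.BlockStable) :
    𝒢.C₀ = BlockEGF.expSeries (𝒢.Bsubst 0) ∧
    𝒢.C₁ = (BlockEGF.expSeries (𝒢.Bsubst 1) - 1) * 𝒢.C₂ ∧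
    𝒢.C₂ = BlockEGF.expSeries (𝒢.Bsubst 2) := by
  refine ⟨?_, ?_, ?_⟩ <;> apply (MvPowerSeries.finSuccEquiv ℚ 2).injective
  · rw [BlockEGF.finSuccEquiv_C₀, BlockEGF.finSuccEquiv_expSeries_Bsubst]
    exact h𝒢.rootedSeries_eq_exp _ (Or.inl rfl)
  · rw [map_mul, map_sub, map_one, BlockEGF.finSuccEquiv_C₁, BlockEGF.finSuccEquiv_C₂,
      BlockEGF.finSuccEquiv_expSeries_Bsubst]
    exact h𝒢.rootedSeries_one _
  · rw [BlockEGF.finSuccEquiv_C₂, BlockEGF.finSuccEquiv_expSeries_Bsubst]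
    exact h𝒢.rootedSeries_eq_exp _ (Or.inr (Or.inr rfl))
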